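/- Let $K_n$ be the complete graph on $V=\{1,\dots,n\}$, $n\ge 1$, with two rational weights $w^+(e)\ge 0$ (reward) and $w^-(e)\ge 0$ (risk) on every edge $e$ (both equal to $0$ on pairs regarded as non-edges), and let $\lambda_1\ge 0$ and $\lambda_2>0$ be rational. For nonempty $S\subseteq V$ put $w^{\pm}(S)=\sum_{e\subseteq S}w^{\pm}(e)$, the sum over the edges with both endpoints in $S$, and $$f(S)=\frac{w^+(S)+\lambda_1|S|}{w^-(S)+\lambda_2|S|}.$$ Let $q_{\max}=\max_{\emptyset\ne S\subseteq V}f(S)$, which is the largest $q$ for which the query "is there a nonempty $S\subseteq V$ with $f(S)\ge q$?" has a positive answer. Then, on the instances with $w^+(e)\ge q_{\max}\,w^-(e)$ for every edge $e$, the problem $\max_{\emptyset\neq S\subseteq V} f(S)$ is solvable in polynomial time. That is, there are a single random access machine program and a single polynomial $p$ such that, on every instance that satisfies this condition, the program (which receives $n$, $\lambda_1,\lambda_2$ and the weights, each rational number as its numerator and denominator, but not $q_{\max}$) halts and outputs a nonempty $S\subseteq V$ that maximizes $f$, within time at most $p(L)$. Here $L$ is the total bit length of the instance, and time is measured by the logarithmic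 cost criterion (every integer operation is charged the bit lengths of the integers and addresses involved). -/

import Mathlib

/-! ### Random access machines with logarithmic cost

Structured programs over integer variables and integer arrays (random access memory, initially
zero).  Every value that is produced while an expression is evaluated is charged its bit length,
and every elementary command is charged one further unit. -/

namespace RAM

/-- The memory: integer variables, and integer arrays with integer addresses. -/
structure State where
  var : ℕ → ℤ
  arr : ℕ → ℤ → ℤ

/-- Integer expressions.  `get a i` is the content of array `a` at the address `i`. -/
inductive Expr where
  | const (c : ℤ)
  | var (x : ℕ)
  | get (a : ℕ) (i : Expr)
  | add (e₁ e₂ : Expr)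
  | sub (e₁ e₂ : Expr)
  | mul (e₁ e₂ : Expr)
  | div (e₁ e₂ : Expr)

/-- Programs.  The tests of `ite` and `loop` (a while loop) are `0 < b`. -/
inductive Program where
  | skip
  | assign (x : ℕ) (e : Expr)
  | store (a : ℕ) (i e : Expr)
  | seq (c d : Program)
  | ite (b : Expr) (c d : Program)
  | loop (b : Expr) (c : Program)

/-- The bit length of an integer, sign included. -/
def bits (z : ℤ) : ℕ := Nat.size z.natAbs + 1

/-- The value of an expression.  (Integer division; division by zero gives zero.) -/
def Expr.eval (s : State) : Expr → ℤ
  | const c => c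
  | var x => s.var x
  | get a i => s.arr a (i.eval s)
  | add e₁ e₂ => e₁.eval s + e₂.eval s
  | sub e₁ e₂ => e₁.eval s - e₂.eval s
  | mul e₁ e₂ => e₁.eval s * e₂.eval s
  | div e₁ e₂ => e₁.eval s / e₂.eval s

/-- The cost of evaluating an expression: the total bit length of the values of all its
subexpressions, addresses included. -/
def Expr.cost (s : State) : Expr → ℕ
  | const c => bits c
  | var x => bits (s.var x)
  | get a i => i.cost s + bits ((get a i).eval s)
  | add e₁ e₂ => e₁.cost s + e₂.cost s + bits ((add e₁ e₂).eval s)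
  | sub e₁ e₂ => e₁.cost s + e₂.cost s + bits ((sub e₁ e₂).eval s)
  | mul e₁ e₂ => e₁.cost s + e₂.cost s + bits ((mul e₁ e₂).eval s)
  | div e₁ e₂ => e₁.cost s + e₂.cost s + bits ((div e₁ e₂).eval s)

/-- Write `v` into the variable `x`. -/
def State.setVar (s : State) (x : ℕ) (v : ℤ) : State :=
  { s with var := Function.update s.var x v }

/-- Write `v` into array `a` at the address `i`. -/
def State.setArr (s : State) (a : ℕ) (i v : ℤ) : State :=
  { s with arr := Function.update s.arr a (Function.update (s.arr a) i v) }

/-- `Exec c s t s'`: the program `c`, started in memory `s`, halts after time `t` in memory `s'`. -/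
inductive Exec : Program → State → ℕ → State → Prop
  | skip (s : State) : Exec .skip s 1 s
  | assign (s : State) (x : ℕ) (e : Expr) :
      Exec (.assign x e) s (1 + e.cost s) (s.setVar x (e.eval s))
  | store (s : State) (a : ℕ) (i e : Expr) :
      Exec (.store a i e) s (1 + i.cost s + e.cost s) (s.setArr a (i.eval s) (e.eval s))
  | seq {c d : Program} {s s₁ s₂ : State} {t₁ t₂ : ℕ} :
      Exec c s t₁ s₁ → Exec d s₁ t₂ s₂ → Exec (.seq c d) s (t₁ + t₂) s₂
  | iteTrue {b : Expr} {c d : Program} {s s₁ : State} {t : ℕ} :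
      0 < b.eval s → Exec c s t s₁ → Exec (.ite b c d) s (1 + b.cost s + t) s₁
  | iteFalse {b : Expr} {c d : Program} {s s₁ : State} {t : ℕ} :
      b.eval s ≤ 0 → Exec d s t s₁ → Exec (.ite b c d) s (1 + b.cost s + t) s₁
  | loopTrue {b : Expr} {c : Program} {s s₁ s₂ : State} {t₁ t₂ : ℕ} :
      0 < b.eval s → Exec c s t₁ s₁ → Exec (.loop b c) s₁ t₂ s₂ →
        Exec (.loop b c) s (1 + b.cost s + t₁ + t₂) s₂
  | loopFalse {b : Expr} {c : Program} {s : State} :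
      b.eval s ≤ 0 → Exec (.loop b c) s (1 + b.cost s) s

end RAM

/-! ### Risk-averse dense subgraph discovery -/

/-- An instance: the complete graph on the nonempty vertex set `Fin n`, in which every edge has a
reward `wPos e ≥ 0` and a risk `wNeg e ≥ 0` (both are zero for a non-edge), and two parameters.
The values of the weights on the diagonal of `Sym2 (Fin n)` are never used. -/
structure RiskAverseDSD where
  n : ℕ
  n_pos : 0 < n
  wPos : Sym2 (Fin n) → ℚ
  wNeg : Sym2 (Fin n) → ℚ
  lam₁ : ℚ
  lam₂ : ℚ
  wPos_nonneg : ∀ e, 0 ≤ wPos e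
  wNeg_nonneg : ∀ e, 0 ≤ wNeg e
  lam₁_nonneg : 0 ≤ lam₁
  lam₂_pos : 0 < lam₂

namespace RiskAverseDSD

/-- The edges `E(S)` of the complete graph that are induced by the vertex set `S`. -/
def inducedEdges {n : ℕ} (S : Finset (Fin n)) : Finset (Sym2 (Fin n)) :=
  {e ∈ S.sym2 | ¬ e.IsDiag}

/-- The objective `(w⁺(S) + λ₁ |S|) / (w⁻(S) + λ₂ |S|)`. -/
def objective (I : RiskAverseDSD) (S : Finset (Fin I.n)) : ℚ :=
  (∑ e ∈ inducedEdges S, I.wPos e + I.lam₁ * (S.card : ℚ)) /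
    (∑ e ∈ inducedEdges S, I.wNeg e + I.lam₂ * (S.card : ℚ))

/-- The nonempty vertex sets. -/
def candidates (I : RiskAverseDSD) : Finset (Finset (Fin I.n)) :=
  {S | S.Nonempty}

theorem candidates_nonempty (I : RiskAverseDSD) : I.candidates.Nonempty :=
  ⟨{⟨0, I.n_pos⟩}, by simp [candidates]⟩

/-- The largest `q` for which the query "is there a nonempty `S` with objective at least `q`?"
has a positive answer, that is, the maximum of the objective. -/
def qMax (I : RiskAverseDSD) : ℚ :=
  I.candidates.sup' I.candidates_nonempty I.objective

/-- `S` is an optimal solution. -/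
def IsOptimal (I : RiskAverseDSD) (S : Finset (Fin I.n)) : Prop :=
  S.Nonempty ∧ ∀ T : Finset (Fin I.n), T.Nonempty → I.objective T ≤ I.objective S

/-- The array that holds the symmetric `n × n` matrix `f` row by row: the entry of the edge `ij`
stands at the address `i * n + j` (and at `j * n + i`); all other cells are zero. -/
def matrixArray {n : ℕ} (f : Sym2 (Fin n) → ℤ) (k : ℤ) : ℤ :=
  ∑ i : Fin n, ∑ j : Fin n,
    if i ≠ j ∧ k = ((i : ℕ) : ℤ) * (n : ℤ) + ((j : ℕ) : ℤ) then f s(i, j) else 0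

/-- The initial memory: `n` and the numerators and denominators of the two parameters in the
variables `0, …, 4`, the numerators and denominators of the weights in the arrays `0, …, 3`. -/
def input (I : RiskAverseDSD) : RAM.State where
  var
    | 0 => (I.n : ℤ)
    | 1 => I.lam₁.num
    | 2 => (I.lam₁.den : ℤ)
    | 3 => I.lam₂.num
    | 4 => (I.lam₂.den : ℤ)
    | _ => 0
  arr
    | 0 => matrixArray fun e => (I.wPos e).num
    | 1 => matrixArray fun e => ((I.wPos e).den : ℤ)
    | 2 => matrixArray fun e => (I.wNeg e).num
    | 3 => matrixArray fun e => ((I.wNeg e).den : ℤ)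
    | _ => fun _ => 0

/-- The bit length of a rational number. -/
def ratBits (x : ℚ) : ℕ := RAM.bits x.num + RAM.bits (x.den : ℤ)

/-- The bit length of an instance, each edge being counted once. -/
def size (I : RiskAverseDSD) : ℕ :=
  RAM.bits (I.n : ℤ) + ratBits I.lam₁ + ratBits I.lam₂ +
    ∑ e ∈ inducedEdges (Finset.univ : Finset (Fin I.n)), (ratBits (I.wPos e) + ratBits (I.wNeg e))

/-- The final memory `s` holds the vertex set `S`, as its indicator vector in array `4`. -/
def Outputs (I : RiskAverseDSD) (s : RAM.State) (S : Finset (Fin I.n)) : Prop :=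
  ∀ v : Fin I.n, s.arr 4 ((v : ℕ) : ℤ) = if v ∈ S then 1 else 0

end RiskAverseDSD

/-! Write `N(S)` and `D(S)` for the numerator and denominator of the objective. The algorithm is
Newton's (Dinkelbach's) method: for the current `S` with `q = N(S) / D(S)`, maximize `N(T) - q D(T)`
over `T`. If the maximum is not positive, `S` is optimal; otherwise the maximizer replaces `S`. The
inner objective is the weight `w⁺ - q w⁻` inside `T` minus a constant `μ` per vertex. Every `q` that
occurs is a value of the objective, hence at most `qMax`, so the promise makes all these edge
weights nonnegative without `qMax` ever being known. The inner problem is therefore of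
densest-subgraph type and solvable by flow.

It is solved by balancing. Split each edge weight between its endpoints and let the load of a vertex
be what it receives. Then the gain of `T` is at most the sum of `load - μ` over `T`
(`Valid.gain_le`), with equality if no vertex of `T` receives anything from an edge leaving `T`. A
push-relabel scheme with labels in `{0, …, n}` shifts weight from overloaded vertices until each
remaining overloaded vertex has label `n`, while underloaded ones keep label `0`. Among `n + 1`
possible labels some `k` is not used by the `n` vertices. The level set above `k` attains equality,
contains all overloaded and no underloaded vertices, and so is a maximizer (`Valid.gain_level`,
`Valid.gain_le_level`). An integer potential, strictly decreased by pushes and relabels, bounds the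
number of sweeps (`Valid.pot_push`, `pot_relabel`).

The number of Newton iterations is logarithmic in the size of the scaled integers. If `h` is the
positive gain `N(S') - q D(S')` of a step, the product `h * D(S')` falls by a factor of at least `4`
from one step to the next, while integrality keeps it above an inverse bound (`Progress.next`,
`Progress.lt`).

For the running time, all data are made integral with the product of the denominators as common
denominator. Every cell then stays below `2 ^ (48 * L ^ 3)`, so each elementary command has
polynomial logarithmic cost, and it remains to count commands. -/

namespace RAM

/-! ### Bit-length and cost bounds for expressions -/

/-- A syntactic size of expressions that controls the bit length of their values. -/
def Expr.weight : Expr → ℕ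
  | const c => c.natAbs + 1
  | var _ => 1
  | get _ i => i.weight + 1
  | add e₁ e₂ => e₁.weight + e₂.weight + 1
  | sub e₁ e₂ => e₁.weight + e₂.weight + 1
  | mul e₁ e₂ => e₁.weight + e₂.weight + 1
  | div e₁ e₂ => e₁.weight + e₂.weight + 1

/-- Every memory cell holds an integer of absolute value at most `2 ^ b`. -/
def State.Bdd (b : ℕ) (s : State) : Prop :=
  (∀ x, |s.var x| ≤ 2 ^ b) ∧ ∀ a i, |s.arr a i| ≤ 2 ^ b

theorem State.Bdd.setVar {b : ℕ} {s : State} (h : s.Bdd b) {v : ℤ} (hv : |v| ≤ 2 ^ b) (x : ℕ) :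
    (s.setVar x v).Bdd b := by
  refine ⟨fun y => ?_, h.2⟩
  by_cases hy : y = x
  · subst hy; simpa [State.setVar] using hv
  · simpa [State.setVar, hy] using h.1 y

theorem State.Bdd.setArr {b : ℕ} {s : State} (h : s.Bdd b) {v : ℤ} (hv : |v| ≤ 2 ^ b) (a : ℕ)
    (i : ℤ) : (s.setArr a i v).Bdd b := by
  refine ⟨h.1, fun a' i' => ?_⟩
  by_cases ha : a' = a
  · subst ha
    by_cases hi : i' = i
    · subst hi; simpa [State.setArr] using hv
    · simpa [State.setArr, hi] using h.2 a' i'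
  · simpa [State.setArr, ha] using h.2 a' i'

theorem two_pow_add_le {b p q : ℕ} (hb : 1 ≤ b) :
    (2 : ℤ) ^ (b * p) + 2 ^ (b * q) ≤ 2 ^ (b * (p + q + 1)) := by
  have h1 : (2 : ℤ) ^ (b * p) ≤ 2 ^ (b * (p + q)) :=
    pow_le_pow_right₀ (by norm_num) (Nat.mul_le_mul_left _ (by omega))
  have h2 : (2 : ℤ) ^ (b * q) ≤ 2 ^ (b * (p + q)) :=
    pow_le_pow_right₀ (by norm_num) (Nat.mul_le_mul_left _ (by omega))
  have h3 : (2 : ℤ) ^ (b * (p + q) + 1) ≤ 2 ^ (b * (p + q + 1)) :=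
    pow_le_pow_right₀ (by norm_num) (by rw [mul_add_one]; omega)
  rw [pow_succ] at h3
  linarith

/-- Products add exponents and weights add as well; sums and differences need one more bit, paid for
by the extra `1` in the weight of a node; integer division does not increase the absolute value. -/
theorem Expr.abs_eval_le {b : ℕ} (hb : 1 ≤ b) {s : State} (hs : s.Bdd b) (e : Expr) :
    |e.eval s| ≤ 2 ^ (b * e.weight) := by
  induction e with
  | const c =>
    have h1 : c.natAbs < 2 ^ c.natAbs := Nat.lt_two_pow_self
    have h2 : 2 ^ c.natAbs ≤ 2 ^ (b * (c.natAbs + 1)) :=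
      Nat.pow_le_pow_right (by norm_num)
        ((Nat.le_succ _).trans (Nat.le_mul_of_pos_left _ hb))
    rw [Expr.eval, Expr.weight, Int.abs_eq_natAbs]
    exact_mod_cast (h1.le.trans h2)
  | var x => simpa [Expr.eval, Expr.weight] using hs.1 x
  | get a i ih =>
    refine (hs.2 a _).trans (pow_le_pow_right₀ (by norm_num) ?_)
    simp only [Expr.weight]; nlinarith [Nat.zero_le (b * i.weight)]
  | add e₁ e₂ h₁ h₂ =>
    exact (abs_add_le _ _).trans ((add_le_add h₁ h₂).trans (two_pow_add_le hb))
  | sub e₁ e₂ h₁ h₂ =>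
    exact (abs_sub _ _).trans ((add_le_add h₁ h₂).trans (two_pow_add_le hb))
  | mul e₁ e₂ h₁ h₂ =>
    rw [Expr.eval, Expr.weight, abs_mul]
    refine (mul_le_mul h₁ h₂ (abs_nonneg _) (by positivity)).trans ?_
    rw [← pow_add]
    exact pow_le_pow_right₀ (by norm_num) (by nlinarith)
  | div e₁ e₂ h₁ h₂ =>
    rw [Expr.eval, Expr.weight]
    have h3 : |e₁.eval s / e₂.eval s| ≤ |e₁.eval s| := by
      rw [Int.abs_eq_natAbs, Int.abs_eq_natAbs]
      exact_mod_cast Int.natAbs_ediv_le_natAbs _ _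
    exact (h3.trans h₁).trans (pow_le_pow_right₀ (by norm_num)
      (Nat.mul_le_mul_left _ (by omega)))

theorem bits_le {z : ℤ} {m : ℕ} (h : |z| ≤ 2 ^ m) : bits z ≤ m + 2 := by
  have h1 : z.natAbs ≤ 2 ^ m := by
    rw [Int.abs_eq_natAbs] at h; exact_mod_cast h
  have h2 : z.natAbs < 2 ^ (m + 1) := h1.trans_lt (Nat.pow_lt_pow_right (by norm_num) (by omega))
  have := Nat.size_le.2 h2
  unfold bits; omega

theorem cost_binary {b p q c₁ c₂ t : ℕ} (h₁ : c₁ ≤ p * (b * p + 2)) (h₂ : c₂ ≤ q * (b * q + 2))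
    (ht : t ≤ b * (p + q + 1) + 2) :
    c₁ + c₂ + t ≤ (p + q + 1) * (b * (p + q + 1) + 2) := by
  nlinarith [Nat.zero_le (b * p * q), Nat.zero_le (b * p), Nat.zero_le (b * q)]

/-- The weight bounds both the number of subexpressions and, through `abs_eval_le`, the bit length
of each value; `cost_binary` is the superadditivity that makes the induction close. -/
theorem Expr.cost_le {b : ℕ} (hb : 1 ≤ b) {s : State} (hs : s.Bdd b) (e : Expr) :
    e.cost s ≤ e.weight * (b * e.weight + 2) := by
  have key := fun e => bits_le (Expr.abs_eval_le hb hs e)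
  induction e with
  | const c =>
    refine (key (.const c)).trans ?_
    exact Nat.le_mul_of_pos_left _ (by simp [Expr.weight])
  | var x =>
    refine (key (.var x)).trans ?_
    exact Nat.le_mul_of_pos_left _ (by simp [Expr.weight])
  | get a i ih =>
    have := key (.get a i)
    simp only [Expr.weight, Expr.cost] at *
    nlinarith [Nat.zero_le (b * i.weight)]
  | add e₁ e₂ h₁ h₂ => exact cost_binary h₁ h₂ (key (.add e₁ e₂))
  | sub e₁ e₂ h₁ h₂ => exact cost_binary h₁ h₂ (key (.sub e₁ e₂))
  | mul e₁ e₂ h₁ h₂ => exact cost_binary h₁ h₂ (key (.mul e₁ e₂))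
  | div e₁ e₂ h₁ h₂ => exact cost_binary h₁ h₂ (key (.div e₁ e₂))

/-- A bound for the cost of one elementary command in a memory bounded by `2 ^ b`, if its
expressions have weight at most `40`. -/
def unitCost (b : ℕ) : ℕ := 1 + 2 * (40 * (b * 40 + 2))

theorem Expr.cost_le_of_weight_le {b : ℕ} (hb : 1 ≤ b) {s : State} (hs : s.Bdd b) {e : Expr}
    (he : e.weight ≤ 40) : e.cost s ≤ 40 * (b * 40 + 2) :=
  (e.cost_le hb hs).trans (by gcongr)

/-! ### Named memory cells -/

/-- The memory of the program: its variables and arrays by name. -/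
structure Mem where
  (n l1n l1d l2n l2d W A B P Q mu go chg u v dl k i : ℤ)
  (wpn wpd wnn wnd s a b x l d : ℤ → ℤ)

/-- The random access memory that stores `m`. -/
def Mem.enc (m : Mem) : State where
  var
    | 0 => m.n | 1 => m.l1n | 2 => m.l1d | 3 => m.l2n | 4 => m.l2d | 5 => m.W | 6 => m.A
    | 7 => m.B | 8 => m.P | 9 => m.Q | 10 => m.mu | 11 => m.go | 12 => m.chg | 13 => m.u
    | 14 => m.v | 15 => m.dl | 16 => m.k | 17 => m.i | _ => 0
  arr
    | 0 => m.wpn | 1 => m.wpd | 2 => m.wnn | 3 => m.wnd | 4 => m.s | 5 => m.a | 6 => m.b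
    | 7 => m.x | 8 => m.l | 9 => m.d | _ => fun _ => 0

/-- Write into a variable of `m`; the inputs are read-only. -/
def Mem.setVar (m : Mem) (x : ℕ) (t : ℤ) : Mem :=
  match x with
  | 5 => { m with W := t } | 6 => { m with A := t } | 7 => { m with B := t }
  | 8 => { m with P := t } | 9 => { m with Q := t } | 10 => { m with mu := t }
  | 11 => { m with go := t } | 12 => { m with chg := t } | 13 => { m with u := t }
  | 14 => { m with v := t } | 15 => { m with dl := t } | 16 => { m with k := t }
  | 17 => { m with i := t } | _ => m

/-- Write into an array of `m`; the inputs are read-only. -/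
def Mem.setArr (m : Mem) (a : ℕ) (i t : ℤ) : Mem :=
  match a with
  | 4 => { m with s := Function.update m.s i t } | 5 => { m with a := Function.update m.a i t }
  | 6 => { m with b := Function.update m.b i t } | 7 => { m with x := Function.update m.x i t }
  | 8 => { m with l := Function.update m.l i t } | 9 => { m with d := Function.update m.d i t }
  | _ => m

theorem Mem.enc_setVar (m : Mem) {x : ℕ} (h : 5 ≤ x ∧ x ≤ 17) (t : ℤ) :
    m.enc.setVar x t = (m.setVar x t).enc := by
  obtain ⟨h1, h2⟩ := h
  unfold State.setVar
  interval_cases x <;>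
  · simp only [Mem.enc, Mem.setVar, State.mk.injEq, and_true]
    funext y
    rcases y with _ | _ | _ | _ | _ | _ | _ | _ | _ | _ | _ | _ | _ | _ | _ | _ | _ | _ | y <;> rfl

theorem Mem.enc_setArr (m : Mem) {a : ℕ} (h : 4 ≤ a ∧ a ≤ 9) (i t : ℤ) :
    m.enc.setArr a i t = (m.setArr a i t).enc := by
  obtain ⟨h1, h2⟩ := h
  unfold State.setArr
  interval_cases a <;>
  · simp only [Mem.enc, Mem.setArr, State.mk.injEq, true_and]
    funext y
    rcases y with _ | _ | _ | _ | _ | _ | _ | _ | _ | _ | y <;> rfl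

/-! ### A program logic that counts elementary commands -/

/-- `Does b c m k Post`: started in the memory `m`, the program `c` halts after at most `k`
elementary commands in a memory that satisfies `Post`; all cells stay bounded by `2 ^ b`. -/
def Does (b : ℕ) (c : Program) (m : Mem) (k : ℕ) (Post : Mem → Prop) : Prop :=
  m.enc.Bdd b → ∃ t m', Exec c m.enc t m'.enc ∧ t ≤ k * unitCost b ∧ m'.enc.Bdd b ∧ Post m'

namespace Does

variable {b : ℕ} {m : Mem} {k : ℕ} {Post : Mem → Prop}

theorem mono {c : Program} {k' : ℕ} {Post' : Mem → Prop} (h : Does b c m k Post) (hk : k ≤ k')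
    (hP : ∀ m', Post m' → Post' m') : Does b c m k' Post' := fun hb => by
  obtain ⟨t, m', h1, h2, h3, h4⟩ := h hb
  exact ⟨t, m', h1, h2.trans (by gcongr), h3, hP _ h4⟩

theorem skip (h : Post m) : Does b .skip m (k + 1) Post := fun hb =>
  ⟨1, m, Exec.skip _, by unfold unitCost; nlinarith [Nat.zero_le (k * b), Nat.zero_le k], hb, h⟩

theorem seq {c d : Program} {k₁ k₂ : ℕ}
    (h : Does b c m k₁ fun m' => Does b d m' k₂ Post) : Does b (.seq c d) m (k₁ + k₂) Post :=
  fun hb => by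
  obtain ⟨t, m', h1, h2, h3, h4⟩ := h hb
  obtain ⟨t', m'', g1, g2, g3, g4⟩ := h4 h3
  exact ⟨t + t', m'', h1.seq g1, by rw [add_mul]; omega, g3, g4⟩

theorem assign [NeZero b] {x : ℕ} {e : Expr} (t : ℤ) (ht : e.eval m.enc = t)
    (hb : m.enc.Bdd b → |t| ≤ 2 ^ b) (h : Post (m.setVar x t))
    (hx : 5 ≤ x ∧ x ≤ 17 := by decide) (hw : e.weight ≤ 40 := by decide) :
    Does b (.assign x e) m (k + 1) Post := fun hm => by
  subst ht
  have hc := Expr.cost_le_of_weight_le (NeZero.one_le) hm hw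
  refine ⟨1 + e.cost m.enc, m.setVar x (e.eval m.enc), ?_, ?_, ?_, h⟩
  · rw [← m.enc_setVar hx]; exact Exec.assign _ _ _
  · rw [add_mul]; unfold unitCost; omega
  · rw [← m.enc_setVar hx]; exact hm.setVar (hb hm) x

theorem store [NeZero b] {a : ℕ} {i e : Expr} (i' t : ℤ) (hi' : i.eval m.enc = i')
    (ht : e.eval m.enc = t) (hb : m.enc.Bdd b → |t| ≤ 2 ^ b) (h : Post (m.setArr a i' t))
    (ha : 4 ≤ a ∧ a ≤ 9 := by decide) (hi : i.weight ≤ 40 := by decide)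
    (hw : e.weight ≤ 40 := by decide) :
    Does b (.store a i e) m (k + 1) Post := fun hm => by
  subst ht hi'
  have hc := Expr.cost_le_of_weight_le (NeZero.one_le) hm hw
  have hc' := Expr.cost_le_of_weight_le (NeZero.one_le) hm hi
  refine ⟨1 + i.cost m.enc + e.cost m.enc, m.setArr a (i.eval m.enc) (e.eval m.enc),
    ?_, ?_, ?_, h⟩
  · rw [← m.enc_setArr ha]; exact Exec.store _ _ _ _
  · rw [add_mul]; unfold unitCost; omega
  · rw [← m.enc_setArr ha]; exact hm.setArr (hb hm) a _

theorem assign_seq [NeZero b] {x : ℕ} {e : Expr} {d : Program} (t : ℤ) (ht : e.eval m.enc = t)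
    (hb : m.enc.Bdd b → |t| ≤ 2 ^ b) (h : Does b d (m.setVar x t) k Post)
    (hx : 5 ≤ x ∧ x ≤ 17 := by decide) (hw : e.weight ≤ 40 := by decide) :
    Does b (.seq (.assign x e) d) m (k + 1) Post := by
  rw [add_comm]
  exact seq (assign (k := 0) t ht hb h hx hw)

theorem store_seq [NeZero b] {a : ℕ} {i e : Expr} {d : Program} (i' t : ℤ)
    (hi' : i.eval m.enc = i') (ht : e.eval m.enc = t) (hb : m.enc.Bdd b → |t| ≤ 2 ^ b)
    (h : Does b d (m.setArr a i' t) k Post)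
    (ha : 4 ≤ a ∧ a ≤ 9 := by decide) (hi : i.weight ≤ 40 := by decide)
    (hw : e.weight ≤ 40 := by decide) :
    Does b (.seq (.store a i e) d) m (k + 1) Post := by
  rw [add_comm]
  exact seq (store (k := 0) i' t hi' ht hb h ha hi hw)

theorem ite [NeZero b] {e : Expr} {c d : Program} (h₁ : 0 < e.eval m.enc → Does b c m k Post)
    (h₂ : e.eval m.enc ≤ 0 → Does b d m k Post) (hw : e.weight ≤ 40 := by decide) :
    Does b (.ite e c d) m (k + 1) Post := fun hb => by
  have hc := Expr.cost_le_of_weight_le (NeZero.one_le) hb hw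
  have : 1 + e.cost m.enc ≤ unitCost b := by unfold unitCost; omega
  by_cases h : 0 < e.eval m.enc
  · obtain ⟨t, m', g1, g2, g3, g4⟩ := h₁ h hb
    exact ⟨_, m', Exec.iteTrue h g1, by rw [add_mul]; omega, g3, g4⟩
  · obtain ⟨t, m', g1, g2, g3, g4⟩ := h₂ (not_lt.1 h) hb
    exact ⟨_, m', Exec.iteFalse (not_lt.1 h) g1, by rw [add_mul]; omega, g3, g4⟩

/-- Since `Exec` describes halting runs, termination has to be proved as well: the index of the
invariant counts the completed rounds, and the test can succeed only while this count is below `K`.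
-/
theorem loop [NeZero b] {e : Expr} {c : Program} (K : ℕ) (Inv : ℕ → Mem → Prop)
    (h₀ : Inv 0 m)
    (hbody : ∀ j m', Inv j m' → 0 < e.eval m'.enc → j < K ∧ Does b c m' k (Inv (j + 1)))
    (hpost : ∀ j m', Inv j m' → e.eval m'.enc ≤ 0 → Post m')
    (hw : e.weight ≤ 40 := by decide) :
    Does b (.loop e c) m (K * (k + 1) + 1) Post := by
  have main : ∀ r j m', Inv j m' → K ≤ j + r → Does b (.loop e c) m' (r * (k + 1) + 1) Post := by
    intro r
    induction r with
    | zero =>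
      intro j m' hI hr hb
      have hc := Expr.cost_le_of_weight_le (NeZero.one_le) hb hw
      by_cases h : 0 < e.eval m'.enc
      · exact absurd (hbody j m' hI h).1 (by omega)
      · exact ⟨_, m', Exec.loopFalse (not_lt.1 h), by unfold unitCost; omega, hb,
          hpost j m' hI (not_lt.1 h)⟩
    | succ r ih =>
      intro j m' hI hr hb
      have hc := Expr.cost_le_of_weight_le (NeZero.one_le) hb hw
      have hu : 1 + e.cost m'.enc ≤ unitCost b := by unfold unitCost; omega
      by_cases h : 0 < e.eval m'.enc
      · obtain ⟨t, m₁, g1, g2, g3, g4⟩ := (hbody j m' hI h).2 hb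
        obtain ⟨t', m₂, f1, f2, f3, f4⟩ := ih (j + 1) m₁ g4 (by omega) g3
        refine ⟨_, m₂, Exec.loopTrue h g1 f1, ?_, f3, f4⟩
        have : ((r + 1) * (k + 1) + 1) * unitCost b
            = unitCost b + k * unitCost b + (r * (k + 1) + 1) * unitCost b := by ring
        omega
      · refine ⟨_, m', Exec.loopFalse (not_lt.1 h), hu.trans ?_, hb, hpost j m' hI (not_lt.1 h)⟩
        exact Nat.le_mul_of_pos_left _ (by omega)
  exact main K 0 m h₀ (by omega)

end Does

/-- `for x = 0, …, e - 1 do c`. -/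
def forTo (x : ℕ) (e : Expr) (c : Program) : Program :=
  .seq (.assign x (.const 0))
    (.loop (.sub e (.var x)) (.seq c (.assign x (.add (.var x) (.const 1)))))

/-- The body has to leave the loop variable and the bound alone. Weight `38` for the bound leaves
room for the loop test, whose weight is larger by two. -/
theorem Does.forTo {b : ℕ} [NeZero b] {m : Mem} {k : ℕ} {Post : Mem → Prop} {x : ℕ} {e : Expr}
    {c : Program} (N : ℕ) (Inv : ℕ → Mem → Prop) (h₀ : Inv 0 (m.setVar x 0))
    (hN : (N : ℤ) ≤ 2 ^ b)
    (hvar : ∀ j m', Inv j m' → m'.enc.var x = j ∧ e.eval m'.enc = N)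
    (hbody : ∀ j m', j < N → Inv j m' → Does b c m' k fun m'' =>
      m''.enc.var x = j ∧ Inv (j + 1) (m''.setVar x (j + 1)))
    (hpost : ∀ m', Inv N m' → Post m')
    (hx : 5 ≤ x ∧ x ≤ 17 := by decide) (hw : e.weight ≤ 38 := by decide) :
    Does b (forTo x e c) m (N * (k + 2) + 2) Post := by
  refine Does.assign_seq 0 rfl (fun _ => by simp) ?_ hx (by simp [Expr.weight])
  refine Does.loop (k := k + 1) N (fun j m' => j ≤ N ∧ Inv j m') ⟨Nat.zero_le _, h₀⟩ ?_ ?_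
    (by simp [Expr.weight]; omega)
  · rintro j m' ⟨hj, hI⟩ hpos
    obtain ⟨h1, h2⟩ := hvar j m' hI
    have hlt : j < N := by
      simp only [Expr.eval, h1, h2] at hpos; omega
    refine ⟨hlt, Does.seq ((hbody j m' hlt hI).mono le_rfl ?_)⟩
    rintro m'' ⟨g1, g2⟩
    refine Does.assign (k := 0) (j + 1) (by simp [Expr.eval, g1]) (fun _ => ?_) ⟨hlt, g2⟩ hx
      (by simp [Expr.weight])
    rw [abs_of_nonneg (by positivity)]
    exact le_trans (by exact_mod_cast hlt) hN
  · rintro j m' ⟨hj, hI⟩ hneg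
    obtain ⟨h1, h2⟩ := hvar j m' hI
    have : j = N := by
      simp only [Expr.eval, h1, h2] at hneg; omega
    exact hpost m' (this ▸ hI)

end RAM

/-! ### Balancing an orientation by pushing and relabelling -/

namespace Balance

variable {V : Type*} [Fintype V]

/-- `X u v` is the part of the weight of the edge `uv` that is assigned to `u`. -/
def load (X : V → V → ℤ) (u : V) : ℤ := ∑ v, X u v

/-- The invariant of the push-relabel algorithm with initial assignment `X₀`, target load `μ` and
distance labels `d`. -/
structure Valid (X₀ : V → V → ℤ) (μ : ℤ) (X : V → V → ℤ) (d : V → ℤ) : Prop where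
  nonneg : ∀ u v, 0 ≤ X u v
  sum_eq : ∀ u v, X u v + X v u = X₀ u v + X₀ v u
  d_nonneg : ∀ u, 0 ≤ d u
  d_le : ∀ u, d u ≤ Fintype.card V
  step : ∀ u v, 0 < X u v → d u ≤ d v + 1
  under : ∀ u, load X u < μ → d u = 0

/-- The potential of the push-relabel algorithm. -/
def pot (μ : ℤ) (X : V → V → ℤ) (d : V → ℤ) : ℤ :=
  (Fintype.card V + 1) * (∑ u, ∑ v, ((Fintype.card V : ℤ) - if 0 < X u v then d v else d u)
    + ∑ u, ((Fintype.card V : ℤ) - d u)) + ∑ u, if μ < load X u then d u else 0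

variable {X₀ X : V → V → ℤ} {μ : ℤ} {d : V → ℤ}

theorem Valid.pot_nonneg (h : Valid X₀ μ X d) : 0 ≤ pot μ X d := by
  have h1 : ∀ u, 0 ≤ (Fintype.card V : ℤ) - d u := fun u => by have := h.d_le u; omega
  refine add_nonneg (mul_nonneg (by positivity) (add_nonneg ?_ ?_)) ?_
  · exact Finset.sum_nonneg fun u _ => Finset.sum_nonneg fun v _ => by
      split_ifs
      exacts [h1 v, h1 u]
  · exact Finset.sum_nonneg fun u _ => h1 u
  · exact Finset.sum_nonneg fun u _ => by
      split_ifs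
      exacts [h.d_nonneg u, le_rfl]

/-- At label zero the sum over active vertices vanishes and every other summand equals `n`; this is
the budget for the number of sweeps. -/
theorem pot_zero_le (μ : ℤ) (X : V → V → ℤ) :
    pot μ X 0 ≤ (Fintype.card V + 1) * (Fintype.card V * (Fintype.card V * Fintype.card V)
      + Fintype.card V * Fintype.card V) := by
  simp [pot]

/-! ### Loads as upper bounds for gains -/

/-- The total weight inside `T` minus `μ |T|`. -/
def gain (X₀ : V → V → ℤ) (μ : ℤ) (T : Finset V) : ℤ := ∑ u ∈ T, ∑ v ∈ T, X₀ u v - μ * T.card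

/-- Twice the sum over `T × T` depends only on the symmetrized matrix, which pushes do not change.
-/
theorem Valid.sum_sum_eq (h : Valid X₀ μ X d) (T : Finset V) :
    ∑ u ∈ T, ∑ v ∈ T, X u v = ∑ u ∈ T, ∑ v ∈ T, X₀ u v := by
  have key : ∀ Y : V → V → ℤ,
      2 * ∑ u ∈ T, ∑ v ∈ T, Y u v = ∑ u ∈ T, ∑ v ∈ T, (Y u v + Y v u) := fun Y => by
    simp_rw [Finset.sum_add_distrib]
    rw [Finset.sum_comm (f := fun u v => Y v u), two_mul]
  have := key X
  simp_rw [h.sum_eq] at this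
  rw [← key X₀] at this
  omega

/-- Weak duality: the load of `u` also counts what `u` receives from edges leaving `T`, and this is
nonnegative. -/
theorem Valid.gain_le (h : Valid X₀ μ X d) (T : Finset V) :
    gain X₀ μ T ≤ ∑ u ∈ T, (load X u - μ) := by
  rw [gain, ← h.sum_sum_eq, Finset.sum_sub_distrib, Finset.sum_const, nsmul_eq_mul, mul_comm μ]
  refine sub_le_sub_right (Finset.sum_le_sum fun u _ => ?_) _
  exact Finset.sum_le_sum_of_subset_of_nonneg (Finset.subset_univ _) fun v _ _ => h.nonneg u v

theorem Valid.gain_nonpos (h : Valid X₀ μ X d) (hn : ∀ u, load X u ≤ μ) (T : Finset V) :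
    gain X₀ μ T ≤ 0 :=
  (h.gain_le T).trans (Finset.sum_nonpos fun u _ => by have := hn u; omega)

/-- Complementary slackness: a positive `X u v` lets the label drop by at most one from `u` to `v`,
so it cannot jump over the unused label `k`. No vertex of the level set receives from an edge
leaving it. -/
theorem Valid.gain_level (h : Valid X₀ μ X d)
    {k : ℤ} (hk : ∀ u, d u ≠ k) :
    gain X₀ μ {u | k < d u} = ∑ u with k < d u, (load X u - μ) := by
  rw [gain, ← h.sum_sum_eq, Finset.sum_sub_distrib, Finset.sum_const, nsmul_eq_mul, mul_comm μ]
  congr 1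
  refine Finset.sum_congr rfl fun u hu => ?_
  refine Finset.sum_subset (Finset.subset_univ _) fun v _ hv => ?_
  simp only [Finset.mem_filter, Finset.mem_univ, true_and, not_lt] at hu hv
  by_contra hne
  have h1 := h.step u v (lt_of_le_of_ne (h.nonneg u v) (Ne.symm hne))
  have := hk v
  omega

/-- Overloaded vertices have label `n`, which exceeds `k` because `k ≤ n` is unused; underloaded
ones have label `0 ≤ k`. Thus the level set collects every positive `load - μ` and no negative one,
which is the best possible value of the bound in `gain_le`. -/
theorem Valid.gain_le_level (h : Valid X₀ μ X d) (hdone : ∀ u, μ < load X u → d u = Fintype.card V)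
    {k : ℤ} (hk : ∀ u, d u ≠ k) (hk0 : 0 ≤ k) (hkn : k ≤ Fintype.card V) (T : Finset V) :
    gain X₀ μ T ≤ gain X₀ μ {u | k < d u} := by
  rw [h.gain_level hk]
  refine (h.gain_le T).trans ?_
  rw [Finset.sum_filter]
  refine (Finset.sum_le_sum (g := fun u => if k < d u then load X u - μ else 0) fun u _ => ?_).trans
    (Finset.sum_le_sum_of_subset_of_nonneg (Finset.subset_univ _) fun u _ _ => ?_)
  · have := hdone u
    have := hk u
    split_ifs <;> omega
  · have := h.under u
    split_ifs <;> omega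

theorem Valid.gain_level_pos (h : Valid X₀ μ X d)
    (hdone : ∀ u, μ < load X u → d u = Fintype.card V)
    {k : ℤ} (hk : ∀ u, d u ≠ k) (hk0 : 0 ≤ k) (hkn : k ≤ Fintype.card V)
    (hex : ∃ u, μ < load X u) :
    0 < gain X₀ μ {u | k < d u} := by
  rw [h.gain_level hk]
  obtain ⟨u, hu⟩ := hex
  have h1 := hdone u hu
  have h2 := hk u
  refine Finset.sum_pos' (fun w hw => ?_) ⟨u, by simp; omega, by omega⟩
  simp only [Finset.mem_filter, Finset.mem_univ, true_and] at hw
  have := h.under w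
  omega

/-! ### Pushes, relabels and the potential -/

section

variable [DecidableEq V]

/-- Move the amount `δ` of the weight of the edge `uv` from `u` to `v`. -/
def push (X : V → V → ℤ) (u v : V) (δ : ℤ) : V → V → ℤ := fun p q =>
  X p q + (if p = v ∧ q = u then δ else 0) - (if p = u ∧ q = v then δ else 0)

theorem load_push (X : V → V → ℤ) (u v : V) (δ : ℤ) (w : V) :
    load (push X u v δ) w
      = load X w + (if w = v then δ else 0) - (if w = u then δ else 0) := by
  simp only [load, push, Finset.sum_sub_distrib, Finset.sum_add_distrib, ite_and]
  congr 1
  · congr 1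
    split_ifs <;> simp
  · split_ifs <;> simp

/-- The reversed arc `v u` may become positive, but it goes up in label and so meets the step
condition. The limit on `δ` by the excess keeps `u` from becoming underloaded. -/
theorem Valid.push {u v : V} {δ : ℤ} (h : Valid X₀ μ X d) (hδ : 0 < δ) (hX : δ ≤ X u v)
    (hl : δ ≤ load X u - μ) (hd : d u = d v + 1) : Valid X₀ μ (push X u v δ) d := by
  have huv : u ≠ v := fun h => by rw [h] at hd; omega
  refine ⟨fun p q => ?_, fun p q => ?_, h.d_nonneg, h.d_le, fun p q => ?_, fun p => ?_⟩
  · have := h.nonneg p q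
    unfold Balance.push
    split_ifs with h1 h2 h2
    · omega
    · omega
    · obtain ⟨rfl, rfl⟩ := h2; omega
    · omega
  · rw [← h.sum_eq p q]
    unfold Balance.push
    simp only [and_comm]
    ring
  · have := h.step p q
    unfold Balance.push
    split_ifs with h1 h2 h2
    · obtain ⟨rfl, rfl⟩ := h1; omega
    · obtain ⟨rfl, rfl⟩ := h1; omega
    · obtain ⟨rfl, rfl⟩ := h2; omega
    · simpa using this
  · rw [load_push]
    have := h.under p
    intro hp
    by_cases h1 : p = u
    · subst h1; simp [huv] at hp; omega
    · refine this ?_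
      simp only [h1, if_false] at hp
      split_ifs at hp <;> omega

/-- A push that empties the arc lowers the first part by at least `n + 1`, more than the label `d v
≤ n` that a newly overloaded `v` may add. Otherwise the excess of `u` is used up: `u` stops
contributing `d u` and `v` adds at most `d v = d u - 1`. -/
theorem Valid.pot_push {u v : V} (h : Valid X₀ μ X d) (hX : 0 < X u v)
    (hl : μ < load X u) (hd : d u = d v + 1) :
    pot μ (Balance.push X u v (min (X u v) (load X u - μ))) d < pot μ X d := by
  set δ := min (X u v) (load X u - μ) with hδ
  have hδ0 : 0 < δ := lt_min hX (by omega)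
  have huv : u ≠ v := fun h => by rw [h] at hd; omega
  have hterm : ∀ p q, ((Fintype.card V : ℤ) - if 0 < Balance.push X u v δ p q then d q else d p)
      ≤ (Fintype.card V : ℤ) - if 0 < X p q then d q else d p := by
    intro p q
    have h0 := h.nonneg p q
    unfold Balance.push
    by_cases h1 : p = v ∧ q = u
    · obtain ⟨rfl, rfl⟩ := h1
      have : 0 < X p q + δ := by omega
      simp only [huv, huv.symm, and_self, if_true, if_false, sub_zero, this]
      split_ifs <;> omega
    · by_cases h2 : p = u ∧ q = v
      · obtain ⟨rfl, rfl⟩ := h2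
        simp only [huv, huv.symm, and_self, if_true, if_false, add_zero, hX]
        split_ifs <;> omega
      · simp [h1, h2]
  -- When the arc is emptied, its term changes from `n - d v` to `n - d u`, which is smaller by one.
  have hsum : (∑ p, ∑ q, ((Fintype.card V : ℤ) - if 0 < Balance.push X u v δ p q then d q else d p))
      ≤ (∑ p, ∑ q, ((Fintype.card V : ℤ) - if 0 < X p q then d q else d p))
        - if δ = X u v then 1 else 0 := by
    split_ifs with hs
    · rw [Int.le_sub_one_iff]
      refine Finset.sum_lt_sum (fun p _ => Finset.sum_le_sum fun q _ => hterm p q)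
        ⟨u, Finset.mem_univ _, Finset.sum_lt_sum (fun q _ => hterm u q) ⟨v, Finset.mem_univ _, ?_⟩⟩
      unfold Balance.push
      simp only [huv, huv.symm, and_self, if_true, if_false, add_zero, hX, hs, sub_self, lt_irrefl]
      omega
    · rw [sub_zero]
      exact Finset.sum_le_sum fun p _ => Finset.sum_le_sum fun q _ => hterm p q
  have hact : (∑ w, if μ < load (Balance.push X u v δ) w then d w else 0)
      ≤ (∑ w, if μ < load X w then d w else 0) + d v - if δ = load X u - μ then d u else 0 := by
    have : (∑ w, if μ < load (Balance.push X u v δ) w then d w else 0)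
        ≤ ∑ w, ((if μ < load X w then d w else 0) + (if w = v then d v else 0)
          - if w = u then (if δ = load X u - μ then d u else 0) else 0) := by
      refine Finset.sum_le_sum fun w _ => ?_
      rw [load_push]
      have hw := h.d_nonneg w
      have hmin : δ ≤ load X u - μ := min_le_right _ _
      by_cases h1 : w = u
      · subst h1
        simp only [huv, if_true, if_false, add_zero, hl]
        split_ifs <;> omega
      · by_cases h2 : w = v
        · subst h2
          simp only [h1, if_true, if_false, sub_zero]
          split_ifs <;> omega
        · simp [h1, h2]
    refine this.trans_eq ?_
    rw [Finset.sum_sub_distrib, Finset.sum_add_distrib]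
    simp
  have hdu := h.d_le u
  have hdv := h.d_nonneg v
  unfold pot
  have hcase : δ = X u v ∨ δ = load X u - μ := min_choice _ _
  by_cases hs : δ = X u v
  · rw [if_pos hs] at hsum
    have : (0 : ℤ) ≤ if δ = load X u - μ then d u else 0 := by split_ifs <;> omega
    nlinarith [mul_le_mul_of_nonneg_left hsum (by positivity : (0 : ℤ) ≤ Fintype.card V + 1)]
  · rw [if_neg hs, sub_zero] at hsum
    rw [if_pos (hcase.resolve_left hs)] at hact
    nlinarith [mul_le_mul_of_nonneg_left hsum (by positivity : (0 : ℤ) ≤ Fintype.card V + 1)]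

/-- Without an admissible arc, every positive `X u v` has `d u ≤ d v`, so there is room for one more
step up. The relabelled vertex is overloaded, so the condition on underloaded vertices is not
affected. -/
theorem Valid.relabel {u : V} (h : Valid X₀ μ X d) (hl : μ < load X u) (hd : d u < Fintype.card V)
    (hno : ∀ v, 0 < X u v → d u ≠ d v + 1) :
    Valid X₀ μ X (Function.update d u (d u + 1)) := by
  refine ⟨h.nonneg, h.sum_eq, fun w => ?_, fun w => ?_, fun p q hpq => ?_, fun w hw => ?_⟩
  · have := h.d_nonneg w
    have := h.d_nonneg u
    rw [Function.update_apply]; split_ifs <;> omega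
  · have := h.d_le w
    rw [Function.update_apply]; split_ifs <;> omega
  · have h1 := h.step p q hpq
    rw [Function.update_apply, Function.update_apply]
    split_ifs with hp hq hq
    · omega
    · subst hp; have := hno q hpq; omega
    · subst hq; omega
    · exact h1
  · rw [Function.update_of_ne (by rintro rfl; omega)]
    exact h.under w hw

/-- The term `n - d u` falls by one and carries the factor `n + 1`, whereas the active sum grows
only by one; the arc terms are antitone in the labels. -/
theorem pot_relabel {u : V} (hl : μ < load X u) :
    pot μ X (Function.update d u (d u + 1)) < pot μ X d := by
  have hup : ∀ w, d w ≤ Function.update d u (d u + 1) w := fun w => by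
    rw [Function.update_apply]; split_ifs with h <;> [subst h; skip] <;> omega
  have h1 : ∑ p, ∑ q, ((Fintype.card V : ℤ) - if 0 < X p q then Function.update d u (d u + 1) q
        else Function.update d u (d u + 1) p)
      ≤ ∑ p, ∑ q, ((Fintype.card V : ℤ) - if 0 < X p q then d q else d p) :=
    Finset.sum_le_sum fun p _ => Finset.sum_le_sum fun q _ => by
      have := hup p; have := hup q; split_ifs <;> omega
  have h2 : ∑ w, ((Fintype.card V : ℤ) - Function.update d u (d u + 1) w)
      = ∑ w, ((Fintype.card V : ℤ) - d w) - 1 := by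
    have : ∀ w, (Fintype.card V : ℤ) - Function.update d u (d u + 1) w
        = (Fintype.card V - d w) - if w = u then 1 else 0 := fun w => by
      rw [Function.update_apply]; split_ifs with h <;> [subst h; skip] <;> omega
    simp_rw [this]
    rw [Finset.sum_sub_distrib]
    simp
  have h3 : (∑ w, if μ < load X w then Function.update d u (d u + 1) w else 0)
      = (∑ w, if μ < load X w then d w else 0) + 1 := by
    have : ∀ w, (if μ < load X w then Function.update d u (d u + 1) w else 0)
        = (if μ < load X w then d w else 0) + if w = u then 1 else 0 := fun w => by
      rw [Function.update_apply]
      by_cases h : w = u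
      · subst h; simp [hl]
      · simp [h]
    simp_rw [this]
    rw [Finset.sum_add_distrib]
    simp
  have hV : (1 : ℤ) ≤ Fintype.card V := by exact_mod_cast Fintype.card_pos_iff.2 ⟨u⟩
  unfold pot
  rw [h2, h3]
  nlinarith [mul_le_mul_of_nonneg_left h1 (by positivity : (0 : ℤ) ≤ Fintype.card V + 1)]

end

end Balance

/-! ### Newton's method for a ratio -/

namespace Newton

variable {ι : Type*} {N D : ι → ℤ} {H : ℤ}

/-- What is known about the current solution `S` after `j` iterations of Newton's method. -/
def Progress (N D : ι → ℤ) (H : ℤ) (j : ℕ) (S : ι) : Prop :=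
  j = 0 ∨ ∃ h : ℚ, 0 ≤ h ∧ 1 ≤ h * D S * H ∧ h * D S * 4 ^ (j - 1) ≤ (H : ℚ) ^ 2 ∧
    ∀ T, (N T : ℚ) - N S / D S * D T ≤ h * (1 - D T / D S)

/-- With `r = D S' / D S`, the old inequality at `T = S'` gives `h' ≤ h * (1 - r)`, so `h' * D S' ≤
r * (1 - r) * h * D S`, and `r * (1 - r) ≤ 1 / 4`. The lower bound is integrality: `D S * h'` is a
positive integer. The inequality for all `T` restates maximality of `S'` at the new ratio, which
exceeds the old one by `h' / D S'`. -/
theorem Progress.next (hN : ∀ S, 0 ≤ N S) (hNH : ∀ S, N S ≤ H) (hD : ∀ S, 0 < D S)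
    (hDH : ∀ S, D S ≤ H) {j : ℕ} {S S' : ι} (hS : Progress N D H j S)
    (hpos : 0 < D S * N S' - N S * D S')
    (hmax : ∀ T, D S * N T - N S * D T ≤ D S * N S' - N S * D S') :
    Progress N D H (j + 1) S' := by
  have hS0 : (0 : ℚ) < D S := by exact_mod_cast hD S
  have hS0' : (0 : ℚ) < D S' := by exact_mod_cast hD S'
  have hSH : (D S : ℚ) ≤ H := by exact_mod_cast hDH S
  have hSH' : (D S' : ℚ) ≤ H := by exact_mod_cast hDH S'
  have hH : (0 : ℚ) ≤ H := hS0.le.trans hSH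
  have hNS : (0 : ℚ) ≤ N S := by exact_mod_cast hN S
  have hNSH' : (N S' : ℚ) ≤ H := by exact_mod_cast hNH S'
  set h' : ℚ := N S' - N S / D S * D S' with hh'
  have hDh : (D S : ℚ) * h' = D S * N S' - N S * D S' := by rw [hh']; field_simp
  have h1 : (1 : ℚ) ≤ D S * h' := by rw [hDh]; exact_mod_cast hpos
  have h'pos : 0 < h' := by
    by_contra hc
    nlinarith [not_lt.1 hc]
  refine Or.inr ⟨h', h'pos.le, ?_, ?_, fun T => ?_⟩
  · have hS1 : (1 : ℚ) ≤ D S' := by exact_mod_cast hD S'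
    calc (1 : ℚ) ≤ D S * h' := h1
      _ ≤ H * h' := by gcongr
      _ = h' * 1 * H := by ring
      _ ≤ h' * D S' * H := by gcongr
  · rw [Nat.add_sub_cancel]
    rcases hS with rfl | ⟨h, h0, -, hb, hT⟩
    · have : h' ≤ N S' := by
        rw [hh']
        have : 0 ≤ (N S : ℚ) / D S * D S' := by positivity
        linarith
      rw [pow_zero, mul_one, sq]
      exact mul_le_mul (this.trans hNSH') hSH' hS0'.le hH
    -- For `j = 0` the truncated exponent `j - 1` equals `j`, so no factor `4` has to be gained and
    -- the trivial bound suffices.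
    · rcases j with _ | j
      · have : h' ≤ N S' := by
          rw [hh']
          have : 0 ≤ (N S : ℚ) / D S * D S' := by positivity
          linarith
        rw [pow_zero, mul_one, sq]
        exact mul_le_mul (this.trans hNSH') hSH' hS0'.le hH
      have hT' := hT S'
      rw [← hh'] at hT'
      set r : ℚ := D S' / D S with hr
      have hrD : (D S' : ℚ) = r * D S := by rw [hr]; field_simp
      have hr0 : 0 < r := by positivity
      have key : h' * D S' * 4 ≤ h * D S := by
        rw [hrD]
        have e1 : h' * r ≤ h * (1 - r) * r := by gcongr
        have e2 : h * (1 - r) * r * 4 ≤ h := by nlinarith [sq_nonneg (2 * r - 1)]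
        have e3 : h' * r * 4 ≤ h := by linarith
        calc h' * (r * D S) * 4 = h' * r * 4 * D S := by ring
          _ ≤ h * D S := by gcongr
      calc h' * D S' * 4 ^ (j + 1) = h' * D S' * 4 * 4 ^ j := by ring
        _ ≤ h * D S * 4 ^ j := by gcongr
        _ ≤ _ := by simpa using hb
  · have hT := hmax T
    have hT' : (D S : ℚ) * N T - N S * D T ≤ D S * h' := by rw [hDh]; exact_mod_cast hT
    have e1 : (N T : ℚ) ≤ h' + N S / D S * D T := by
      have e2 : (N T : ℚ) = (D S * N T - N S * D T) / D S + N S / D S * D T := by field_simp; ring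
      rw [e2]
      gcongr
      rw [div_le_iff₀ hS0]; linarith
    have e3 : (N S' : ℚ) / D S' = h' / D S' + N S / D S := by rw [hh']; field_simp; ring
    rw [e3]
    have e4 : h' * (1 - D T / D S') = h' - h' / D S' * D T := by field_simp
    rw [e4, add_mul]
    linarith

/-- The two bounds on `h * D S` give `4 ^ (j - 1) ≤ H ^ 3 = 2 ^ (3 * m)`. -/
theorem Progress.lt {m j : ℕ} {S : ι} (hS : Progress N D (2 ^ m) j S) : j < 2 * m + 2 := by
  rcases hS with rfl | ⟨h, h0, h1, h2, -⟩
  · omega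
  · have e1 : (4 : ℚ) ^ (j - 1) ≤ (2 : ℚ) ^ (3 * m) := by
      push_cast at h1 h2
      calc (4 : ℚ) ^ (j - 1) ≤ (h * D S * 2 ^ m) * 4 ^ (j - 1) :=
            le_mul_of_one_le_left (by positivity) h1
        _ = (h * D S * 4 ^ (j - 1)) * 2 ^ m := by ring
        _ ≤ ((2 ^ m) ^ 2) * 2 ^ m := by gcongr
        _ = 2 ^ (3 * m) := by ring
    have e2 : (4 : ℚ) ^ (j - 1) = 2 ^ (2 * (j - 1)) := by rw [pow_mul]; norm_num
    rw [e2] at e1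
    have := (pow_le_pow_iff_right₀ (by norm_num : (1 : ℚ) < 2)).1 e1
    omega

end Newton

/-! ### Arithmetic notation for expressions -/

namespace RAM

instance : Add Expr := ⟨.add⟩
instance : Sub Expr := ⟨.sub⟩
instance : Mul Expr := ⟨.mul⟩
instance : Div Expr := ⟨.div⟩
instance (k : ℕ) : OfNat Expr k := ⟨.const k⟩

@[simp] theorem Expr.eval_add (e f : Expr) (s : State) :
    (e + f).eval s = e.eval s + f.eval s := rfl

@[simp] theorem Expr.eval_sub (e f : Expr) (s : State) :
    (e - f).eval s = e.eval s - f.eval s := rfl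

@[simp] theorem Expr.eval_mul (e f : Expr) (s : State) :
    (e * f).eval s = e.eval s * f.eval s := rfl

@[simp] theorem Expr.eval_one (s : State) : (1 : Expr).eval s = 1 := rfl

end RAM

namespace DSD

open RAM Balance

/-! Expressions for the cells of the memory. -/

def vn : Expr := .var 0
def vW : Expr := .var 5
def vA : Expr := .var 6
def vB : Expr := .var 7
def vP : Expr := .var 8
def vQ : Expr := .var 9
def vmu : Expr := .var 10
def vgo : Expr := .var 11
def vchg : Expr := .var 12
def vu : Expr := .var 13
def vv : Expr := .var 14
def vdl : Expr := .var 15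
def vk : Expr := .var 16
def vi : Expr := .var 17
def xs (i : Expr) : Expr := .get 4 i
def xa (i : Expr) : Expr := .get 5 i
def xb (i : Expr) : Expr := .get 6 i
def xx (i : Expr) : Expr := .get 7 i
def xl (i : Expr) : Expr := .get 8 i
def xd (i : Expr) : Expr := .get 9 i
def uv : Expr := vu * vn + vv
def vu' : Expr := vv * vn + vu

section eval

variable (m : Mem) (e : Expr)

@[simp] theorem eval_vn : vn.eval m.enc = m.n := rfl
@[simp] theorem eval_vA : vA.eval m.enc = m.A := rfl
@[simp] theorem eval_vB : vB.eval m.enc = m.B := rfl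
@[simp] theorem eval_vP : vP.eval m.enc = m.P := rfl
@[simp] theorem eval_vQ : vQ.eval m.enc = m.Q := rfl
@[simp] theorem eval_vmu : vmu.eval m.enc = m.mu := rfl
@[simp] theorem eval_vu : vu.eval m.enc = m.u := rfl
@[simp] theorem eval_vv : vv.eval m.enc = m.v := rfl
@[simp] theorem eval_vdl : vdl.eval m.enc = m.dl := rfl
@[simp] theorem eval_vk : vk.eval m.enc = m.k := rfl
@[simp] theorem eval_xs : (xs e).eval m.enc = m.s (e.eval m.enc) := rfl
@[simp] theorem eval_xa : (xa e).eval m.enc = m.a (e.eval m.enc) := rfl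
@[simp] theorem eval_xb : (xb e).eval m.enc = m.b (e.eval m.enc) := rfl
@[simp] theorem eval_xx : (xx e).eval m.enc = m.x (e.eval m.enc) := rfl
@[simp] theorem eval_xl : (xl e).eval m.enc = m.l (e.eval m.enc) := rfl
@[simp] theorem eval_xd : (xd e).eval m.enc = m.d (e.eval m.enc) := rfl
@[simp] theorem eval_uv : uv.eval m.enc = m.u * m.n + m.v := rfl
@[simp] theorem eval_vu' : vu'.eval m.enc = m.v * m.n + m.u := rfl

end eval

attribute [simp] Mem.setVar Mem.setArr

/-- The part of the memory that is not used as working space by the balancing phase. -/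
def core (m : Mem) : Mem :=
  { m with x := 0, l := 0, d := 0, u := 0, v := 0, dl := 0, chg := 0, go := 0, k := 0, i := 0 }

theorem core_setArr (m : Mem) {a : ℕ} (h : 7 ≤ a) (i t : ℤ) : core (m.setArr a i t) = core m := by
  unfold Mem.setArr
  split <;> first | rfl | omega

/-- Row-major addressing is injective as long as the column indices are below `N`. -/
theorem index_inj {N p q p' q' : ℕ} (hq : q < N) (hq' : q' < N) :
    (p : ℤ) * N + q = p' * N + q' ↔ p = p' ∧ q = q' := by
  refine ⟨fun h => ?_, by rintro ⟨rfl, rfl⟩; rfl⟩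
  have h' : p * N + q = p' * N + q' := by exact_mod_cast h
  have hp : p = p' := by
    have h1 := congrArg (· / N) h'
    have hN : 0 < N := by omega
    simpa [Nat.add_div_of_dvd_right (Dvd.intro_left p rfl),
      Nat.add_div_of_dvd_right (Dvd.intro_left p' rfl), Nat.mul_div_cancel _ hN,
      Nat.div_eq_of_lt hq, Nat.div_eq_of_lt hq'] using h1
  subst hp
  exact ⟨rfl, by omega⟩

/-! ### Initialization of the assignment -/

/-- The initial assignment. -/
def x₀ (m : Mem) (N p q : ℕ) : ℤ := m.Q * m.a (p * N + q) - m.P * m.b (p * N + q)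

def initRow : Program :=
  forTo 14 vn (.seq (.store 7 uv (vQ * xa uv - vP * xb uv)) (.store 8 vu (xl vu + xx uv)))

def initAll : Program :=
  forTo 13 vn (.seq (.store 8 vu 0) (.seq (.store 9 vu 0) initRow))

variable {b : ℕ} [NeZero b]

theorem initRow_does {N u : ℕ} {m : Mem} (hn : m.n = N) (hu : u < N) (hmu : m.u = u)
    (hl : m.l u = 0) {c : ℤ} (hX : ∀ p q, p < N → q < N → 0 ≤ x₀ m N p q ∧ x₀ m N p q ≤ c)
    (hc : N * c ≤ 2 ^ b) (hN : (N : ℤ) ≤ 2 ^ b)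
    (hx : ∀ p q : ℕ, p < u → q < N → m.x (p * N + q) = x₀ m N p q) :
    Does b initRow m (N * 4 + 2) fun m' => core m' = core m ∧ m'.u = u ∧ m'.d = m.d ∧
      (∀ p q : ℕ, p < u + 1 → q < N → m'.x (p * N + q) = x₀ m N p q) ∧
      (∀ p : ℕ, p ≠ u → m'.l p = m.l p) ∧ m'.l u = ∑ q ∈ Finset.range N, x₀ m N u q := by
  refine Does.forTo (k := 2) N (fun j m' => m'.v = j ∧ core m' = core m ∧ m'.u = u ∧ m'.d = m.d ∧
    (∀ p q : ℕ, (p < u ∧ q < N ∨ p = u ∧ q < j) → m'.x (p * N + q) = x₀ m N p q) ∧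
      (∀ p : ℕ, p ≠ u → m'.l p = m.l p) ∧ m'.l u = ∑ q ∈ Finset.range j, x₀ m N u q)
    ⟨rfl, rfl, hmu, rfl, ?_, fun _ _ => rfl, ?_⟩ hN ?_ ?_ ?_
  · rintro p q (h | h)
    · exact hx p q h.1 h.2
    · omega
  · simpa using hl
  · rintro j m' ⟨hv, hco, -⟩
    -- Equality of cores serves as frame condition: `core` leaves these fields untouched
    -- definitionally, so projecting the equation shows that they did not change.
    exact ⟨hv, (congrArg Mem.n hco :).trans hn⟩
  · rintro j m' hj ⟨hv, hco, hu', hd, h1, h2, h3⟩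
    have hn' : m'.n = N := (congrArg Mem.n hco :).trans hn
    have hb0 := hX u j hu hj
    have hNpos : (1 : ℤ) ≤ N := by exact_mod_cast (by omega : 1 ≤ N)
    have hsum : m'.l u + x₀ m N u j = ∑ q ∈ Finset.range (j + 1), x₀ m N u q := by
      rw [Finset.sum_range_succ, h3]
    refine Does.store_seq (k := 1) (u * N + j) (x₀ m N u j) (by simp [hu', hv, hn']) ?_
      (fun _ => ?_) (Does.store (k := 0) u (m'.l u + x₀ m N u j) hu' ?_ (fun _ => ?_)
        ⟨hv, rfl, hco, hu', hd, ?_, ?_, ?_⟩)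
    · have e1 : m'.Q = m.Q := (congrArg Mem.Q hco :)
      have e2 : m'.P = m.P := (congrArg Mem.P hco :)
      have e3 : m'.a = m.a := (congrArg Mem.a hco :)
      have e4 : m'.b = m.b := (congrArg Mem.b hco :)
      simp [hu', hv, hn', e1, e2, e3, e4, x₀]
    · rw [abs_of_nonneg hb0.1]
      nlinarith
    · simp [hu', hv, hn']
    · rw [hsum, abs_of_nonneg]
      · calc _ ≤ ∑ q ∈ Finset.range (j + 1), c :=
              Finset.sum_le_sum fun q hq => (hX u q hu (by simp at hq; omega)).2
          _ = ((j + 1 : ℕ) : ℤ) * c := by simp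
          _ ≤ N * c := by
              have : ((j + 1 : ℕ) : ℤ) ≤ N := by exact_mod_cast hj
              exact mul_le_mul_of_nonneg_right this (hb0.1.trans hb0.2)
          _ ≤ _ := hc
      · exact Finset.sum_nonneg fun q hq => (hX u q hu (by simp at hq; omega)).1
    · rintro p q hpq
      show Function.update m'.x _ _ _ = _
      simp only [Function.update_apply, index_inj (show q < N by omega) hj]
      split_ifs with h
      · rw [h.1, h.2]
      · exact h1 p q (by omega)
    · rintro p hp
      show Function.update m'.l u _ _ = _
      rw [Function.update_of_ne (by exact_mod_cast hp)]
      exact h2 p hp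
    · show Function.update m'.l u _ _ = _
      rw [Function.update_self, hsum]
  · rintro m' ⟨-, hco, hu', hd, h1, h2, h3⟩
    exact ⟨hco, hu', hd, fun p q hp hq => h1 p q (by omega), h2, h3⟩

theorem initAll_does {N : ℕ} {m : Mem} (hn : m.n = N)
    {c : ℤ} (hX : ∀ p q, p < N → q < N → 0 ≤ x₀ m N p q ∧ x₀ m N p q ≤ c)
    (hc : N * c ≤ 2 ^ b) (hN : (N : ℤ) ≤ 2 ^ b) :
    Does b initAll m (N * (N * 4 + 6) + 2) fun m' => core m' = core m ∧
      (∀ p q : ℕ, p < N → q < N → m'.x (p * N + q) = x₀ m N p q) ∧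
      (∀ p : ℕ, p < N → m'.l p = ∑ q ∈ Finset.range N, x₀ m N p q) ∧
      ∀ p : ℕ, p < N → m'.d p = 0 := by
  refine Does.forTo (k := N * 4 + 4) N (fun j m' => core m' = core m ∧ m'.u = j ∧
      (∀ p q : ℕ, p < j → q < N → m'.x (p * N + q) = x₀ m N p q) ∧
      (∀ p : ℕ, p < j → m'.l p = ∑ q ∈ Finset.range N, x₀ m N p q) ∧
      ∀ p : ℕ, p < j → m'.d p = 0)
    ⟨rfl, rfl, fun _ _ h => by omega, fun _ h => by omega, fun _ h => by omega⟩ hN ?_ ?_ ?_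
  · rintro j m' ⟨hco, hu, -⟩
    exact ⟨hu, (congrArg Mem.n hco :).trans hn⟩
  · rintro j m' hj ⟨hco, hu, h1, h2, h3⟩
    have e0 : ∀ p q, x₀ m' N p q = x₀ m N p q := fun p q => by
      have e1 : m'.Q = m.Q := (congrArg Mem.Q hco :)
      have e2 : m'.P = m.P := (congrArg Mem.P hco :)
      have e3 : m'.a = m.a := (congrArg Mem.a hco :)
      have e4 : m'.b = m.b := (congrArg Mem.b hco :)
      simp only [x₀, e1, e2, e3, e4]
    refine Does.store_seq (k := N * 4 + 3) j 0 hu rfl (by simp) <|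
      Does.store_seq (k := N * 4 + 2) j 0 hu rfl (by simp) <|
      (initRow_does (N := N) (u := j) (c := c) ?_ hj ?_ ?_ ?_ hc hN ?_).mono le_rfl ?_
    · exact (congrArg Mem.n hco :).trans hn
    · exact hu
    · show Function.update m'.l j 0 j = 0
      rw [Function.update_self]
    · intro p q hp hq
      show 0 ≤ x₀ m' N p q ∧ x₀ m' N p q ≤ c
      rw [e0]
      exact hX p q hp hq
    · intro p q hp hq
      show m'.x _ = x₀ m' N p q
      rw [e0]
      exact h1 p q hp hq
    · rintro m'' ⟨g0, g1, gd, g2, g3, g4⟩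
      refine ⟨g1, g0.trans hco, rfl, fun p q hp hq => ?_, fun p hp => ?_, fun p hp => ?_⟩
      · exact (g2 p q hp hq).trans (e0 p q)
      · rcases eq_or_ne p j with rfl | hpj
        · exact g4.trans (Finset.sum_congr rfl fun q _ => e0 p q)
        · refine (g3 p hpj).trans ?_
          show Function.update m'.l j 0 p = _
          rw [Function.update_of_ne (by exact_mod_cast hpj)]
          exact h2 p (by omega)
      · show m''.d p = 0
        rw [gd]
        show Function.update m'.d j 0 p = _
        rw [Function.update_apply]
        split_ifs with h
        · rfl
        · refine h3 p ?_
          have : p ≠ j := by exact_mod_cast h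
          omega
  · rintro m' ⟨hco, -, h1, h2, h3⟩
    exact ⟨hco, h1, h2, h3⟩

end DSD

namespace DSD

open RAM Balance

variable {b : ℕ}

/-! ### The balancing phase -/

/-- The memory `m` holds the assignment `X`, its loads, and the labels `d`. -/
structure Flow (N : ℕ) (X : Fin N → Fin N → ℤ) (d : Fin N → ℤ) (m : Mem) : Prop where
  n : m.n = N
  x : ∀ u v : Fin N, m.x (u * N + v) = X u v
  l : ∀ u : Fin N, m.l u = load X u
  d : ∀ u : Fin N, m.d u = d u

/-- All numbers that occur while `X₀` is balanced with target load `μ` fit into `b` bits. -/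
structure Fits (b N : ℕ) (X₀ : Fin N → Fin N → ℤ) (μ c : ℤ) : Prop where
  le : ∀ u v, X₀ u v + X₀ v u ≤ c
  mul_le : N * c + |μ| ≤ 2 ^ b
  lt : (N : ℤ) + 1 ≤ 2 ^ b

section

variable {N : ℕ} {X₀ X : Fin N → Fin N → ℤ} {μ c : ℤ} {d : Fin N → ℤ} {m : Mem}

/-- The two shares of an edge are nonnegative and their sum never changes, so neither can exceed the
original sum. All later bounds on cells rest on this. -/
theorem Fits.x_le (h : Fits b N X₀ μ c) (hV : Valid X₀ μ X d) (u v : Fin N) : X u v ≤ c := by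
  have h1 := hV.sum_eq u v
  have h2 := hV.nonneg v u
  have h3 := h.le u v
  omega

theorem Fits.load_le (h : Fits b N X₀ μ c) (hV : Valid X₀ μ X d) (u : Fin N) :
    load X u ≤ N * c :=
  (Finset.sum_le_sum fun v _ => h.x_le hV u v).trans_eq (by simp)

theorem _root_.Balance.Valid.load_nonneg (hV : Valid X₀ μ X d) (u : Fin N) : 0 ≤ load X u :=
  Finset.sum_nonneg fun v _ => hV.nonneg u v

theorem Fits.abs_x_le (h : Fits b N X₀ μ c) (hV : Valid X₀ μ X d) (u v : Fin N) :
    |X u v| ≤ 2 ^ b := by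
  rw [abs_of_nonneg (hV.nonneg u v)]
  have h1 : X u v ≤ load X u :=
    Finset.single_le_sum (f := X u) (fun w _ => hV.nonneg u w) (Finset.mem_univ v)
  have := h.load_le hV u
  have := h.mul_le
  have := abs_nonneg μ
  omega

theorem Fits.abs_load_le (h : Fits b N X₀ μ c) (hV : Valid X₀ μ X d) (u : Fin N) :
    |load X u| ≤ 2 ^ b := by
  rw [abs_of_nonneg (hV.load_nonneg u)]
  have := h.load_le hV u
  have := h.mul_le
  have := abs_nonneg μ
  omega

theorem Fits.abs_excess_le (h : Fits b N X₀ μ c) (hV : Valid X₀ μ X d) (u : Fin N) :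
    |load X u - μ| ≤ 2 ^ b := by
  have h1 := h.load_le hV u
  have h2 := hV.load_nonneg u
  have h3 := h.mul_le
  have h4 := abs_sub (load X u) μ
  rw [abs_of_nonneg h2] at h4
  omega

variable [NeZero b]

/-- An equality test for a machine that can only test positivity. -/
theorem one_sub_mul_self_pos {t : ℤ} : 0 < 1 - t * t ↔ t = 0 := by
  refine ⟨fun h => ?_, fun h => by simp [h]⟩
  by_contra hne
  have := Int.one_le_abs hne
  nlinarith [abs_mul_abs_self t]

/-- Move `dl` units from `u` to `v`. -/
def moveArc : Program :=
  .seq (.store 7 uv (xx uv - vdl)) <| .seq (.store 7 vu' (xx vu' + vdl)) <|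
    .seq (.store 8 vu (xl vu - vdl)) (.store 8 vv (xl vv + vdl))

/-- Validity of the result is a hypothesis because it is what bounds the newly written cells. -/
theorem moveArc_does {u v : Fin N} {δ : ℤ} (hF : Flow N X d m)
    (hV' : Valid X₀ μ (push X u v δ) d) (huv : u ≠ v)
    (hB : Fits b N X₀ μ c) (hu : m.u = u) (hv : m.v = v) (hdl : m.dl = δ) :
    Does b moveArc m 4 fun m' => core m' = core m ∧ m'.u = m.u ∧ m'.v = m.v ∧ m'.chg = m.chg ∧
      Flow N (push X u v δ) d m' := by
  have huv' : (u : ℕ) ≠ v := fun h => huv (Fin.ext h)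
  have huv'' : ((v : ℕ) : ℤ) ≠ (u : ℕ) := by exact_mod_cast huv'.symm
  have e1 : X u v - δ = push X u v δ u v := by simp [push, huv]
  have e2 : X v u + δ = push X u v δ v u := by simp [push, huv.symm]
  have e3 : load X u - δ = load (push X u v δ) u := by rw [load_push]; simp [huv]
  have e4 : load X v + δ = load (push X u v δ) v := by rw [load_push]; simp [huv.symm]
  refine Does.store_seq (k := 3) (u * N + v) (push X u v δ u v) (by simp [hu, hv, hF.n])
    (by rw [← e1]; simp [hu, hv, hF.n, hF.x, hdl]) (fun _ => hB.abs_x_le hV' u v) ?_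
  refine Does.store_seq (k := 2) (v * N + u) (push X u v δ v u) (by simp [hu, hv, hF.n])
    ?_ (fun _ => hB.abs_x_le hV' v u) ?_
  · rw [← e2]
    simp only [Expr.eval_add, eval_xx, eval_vu', eval_vdl, Mem.setArr, hu, hv, hF.n, hdl]
    rw [Function.update_of_ne, hF.x]
    rw [Ne, index_inj u.2 v.2]
    omega
  refine Does.store_seq (k := 1) u (load (push X u v δ) u) (by simp [hu])
    (by rw [← e3]; simp [hu, hF.l, hdl]) (fun _ => hB.abs_load_le hV' u) ?_
  refine Does.store (k := 0) v (load (push X u v δ) v) (by simp [hv]) ?_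
      (fun _ => hB.abs_load_le hV' v) ⟨?_, by simp only [Mem.setArr],
        by simp only [Mem.setArr], by simp only [Mem.setArr], ⟨?_, fun p q => ?_,
        fun p => ?_, fun p => ?_⟩⟩
  · rw [← e4]
    simp [hv, hF.l, huv'', hdl]
  · iterate 4 rw [core_setArr _ (by decide)]
  · simpa only [Mem.setArr] using hF.n
  · simp only [Mem.setArr, Function.update_apply, index_inj q.2 u.2, index_inj q.2 v.2, hF.x]
    simp only [← Fin.ext_iff]
    split_ifs with h1 h2
    · rw [h1.1, h1.2]
    · rw [h2.1, h2.2]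
    · simp [push, h1, h2]
  · simp only [Mem.setArr, Function.update_apply, hF.l, Nat.cast_inj]
    simp only [← Fin.ext_iff]
    split_ifs with h1 h2
    · rw [h1]
    · rw [h2]
    · rw [load_push]; simp [h1, h2]
  · simpa only [Mem.setArr] using hF.d p

/-- Move `dl` units from `u` to `v`, if `dl` is positive and the labels allow it. -/
def tryMove : Program :=
  .ite vdl (.ite (1 - (xd vu - xd vv - 1) * (xd vu - xd vv - 1)) moveArc .skip) .skip

theorem tryMove_does {u v : Fin N} (hF : Flow N X d m) (hV : Valid X₀ μ X d)
    (hB : Fits b N X₀ μ c) (hu : m.u = u) (hv : m.v = v)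
    (hdl : m.dl = min (X u v) (load X u - μ)) :
    Does b tryMove m 9 fun m' => core m' = core m ∧ m'.u = m.u ∧ m'.v = m.v ∧ m'.chg = m.chg ∧
      (Flow N X d m' ∧ ¬ (0 < X u v ∧ μ < load X u ∧ d u = d v + 1) ∨
        Flow N (push X u v (min (X u v) (load X u - μ))) d m' ∧
          0 < X u v ∧ μ < load X u ∧ d u = d v + 1) := by
  have htest : 0 < (1 - (xd vu - xd vv - 1) * (xd vu - xd vv - 1) : Expr).eval m.enc
      ↔ d u = d v + 1 := by
    simp only [Expr.eval_sub, Expr.eval_mul, Expr.eval_one, one_sub_mul_self_pos]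
    simp only [eval_xd, eval_vu, eval_vv, hu, hv, hF.d]
    omega
  refine Does.ite (k := 8) (fun h => ?_) (fun h => ?_)
  · replace h : 0 < m.dl := h
    rw [hdl] at h
    have hx0 : 0 < X u v := lt_of_lt_of_le h (min_le_left _ _)
    have hl0 : μ < load X u := by
      have := lt_of_lt_of_le h (min_le_right _ _); omega
    refine Does.ite (k := 7) (fun h' => ?_) (fun h' => ?_)
    · have hd := htest.1 h'
      have huv : u ≠ v := fun h => by rw [h] at hd; omega
      refine (moveArc_does hF (hV.push h (min_le_left _ _) (min_le_right _ _) hd) huv hB hu hv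
        hdl).mono (by norm_num) ?_
      rintro m' ⟨h1, h2, h3, h4, h5⟩
      exact ⟨h1, h2, h3, h4, Or.inr ⟨h5, hx0, hl0, hd⟩⟩
    · refine Does.skip (k := 6) ⟨rfl, rfl, rfl, rfl, Or.inl ⟨hF, fun hc => ?_⟩⟩
      exact absurd (htest.2 hc.2.2) (not_lt.2 h')
  · replace h : m.dl ≤ 0 := h
    rw [hdl] at h
    refine Does.skip (k := 7) ⟨rfl, rfl, rfl, rfl, Or.inl ⟨hF, fun hc => ?_⟩⟩
    have : 0 < min (X u v) (load X u - μ) := lt_min hc.1 (by omega)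
    omega

/-- Push from `u` to `v`, if possible. -/
def pushArc : Program :=
  .seq (.assign 15 (xl vu - vmu)) <|
    .seq (.ite (vdl - xx uv) (.assign 15 (xx uv)) .skip) tryMove

theorem pushArc_does {u v : Fin N} (hF : Flow N X d m) (hV : Valid X₀ μ X d)
    (hB : Fits b N X₀ μ c) (hmu : m.mu = μ) (hu : m.u = u) (hv : m.v = v) :
    Does b pushArc m 12 fun m' => core m' = core m ∧ m'.u = m.u ∧ m'.v = m.v ∧ m'.chg = m.chg ∧
      (Flow N X d m' ∧ ¬ (0 < X u v ∧ μ < load X u ∧ d u = d v + 1) ∨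
        Flow N (push X u v (min (X u v) (load X u - μ))) d m' ∧
          0 < X u v ∧ μ < load X u ∧ d u = d v + 1) := by
  set δ := min (X u v) (load X u - μ) with hδ
  refine Does.assign_seq (k := 11) (load X u - μ) (by simp [hu, hmu, hF.l])
    (fun _ => hB.abs_excess_le hV u) <|
    Does.seq (k₁ := 2) (k₂ := 9) <| Does.mono (k := 2)
      (Post := fun m' => m' = { m with dl := δ }) ?_ le_rfl ?_
  · refine Does.ite (k := 1) (fun h => Does.assign (k := 0) (X u v) (by simp [hu, hv, hF.n, hF.x])
      (fun _ => hB.abs_x_le hV u v) ?_) (fun h => Does.skip (k := 0) ?_)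
    · simp [hu, hv, hF.n, hF.x] at h
      simp only [Mem.setVar]
      rw [hδ, min_eq_left (by omega)]
    · simp [hu, hv, hF.n, hF.x] at h
      simp only [Mem.setVar]
      rw [hδ, min_eq_right (by omega)]
  · rintro _ rfl
    exact tryMove_does (m := { m with dl := δ }) ⟨hF.n, hF.x, hF.l, hF.d⟩ hV hB hu hv hδ

/-- Push from `u` to all its neighbours. -/
def pushRow : Program := forTo 14 vn pushArc

/-- Pushes along other arcs of the row leave `X u w` alone, so an arc found inadmissible or emptied
stays so, as long as `u` remains overloaded. The final clause is what `Valid.relabel` requires. -/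
theorem pushRow_does {u : Fin N} (hF : Flow N X d m) (hV : Valid X₀ μ X d)
    (hB : Fits b N X₀ μ c) (hmu : m.mu = μ) (hu : m.u = u) :
    Does b pushRow m (N * 14 + 2) fun m' => core m' = core m ∧ m'.u = m.u ∧ m'.chg = m.chg ∧
      ∃ X', Flow N X' d m' ∧ Valid X₀ μ X' d ∧ (X' = X ∨ pot μ X' d < pot μ X d) ∧
        (μ < load X' u → ∀ w, 0 < X' u w → d u ≠ d w + 1) := by
  refine Does.forTo (k := 12) N (fun j m' => core m' = core m ∧ m'.u = m.u ∧ m'.v = j ∧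
    m'.chg = m.chg ∧
      ∃ X', Flow N X' d m' ∧ Valid X₀ μ X' d ∧ (X' = X ∨ pot μ X' d < pot μ X d) ∧
        (μ < load X' u → ∀ w : Fin N, (w : ℕ) < j → 0 < X' u w → d u ≠ d w + 1))
    ⟨rfl, rfl, rfl, rfl, X, ⟨hF.n, hF.x, hF.l, hF.d⟩, hV, Or.inl rfl, fun _ _ h => by omega⟩
    (by have := hB.lt; omega) ?_ ?_ ?_
  · rintro j m' ⟨hco, -, hv, -⟩
    exact ⟨hv, (congrArg Mem.n hco :).trans hF.n⟩
  · rintro j m' hj ⟨hco, hu', hv, hchg, X', hF', hV', hpot, hsat⟩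
    refine (pushArc_does (v := ⟨j, hj⟩) hF' hV' hB ((congrArg Mem.mu hco :).trans hmu)
      (hu'.trans hu) hv).mono le_rfl ?_
    rintro m'' ⟨g1, g2, g3, g4, ⟨g5, g6⟩ | ⟨g5, g6, g7, g8⟩⟩
    · refine ⟨g3.trans hv, g1.trans hco, g2.trans hu', rfl, g4.trans hchg, X',
        ⟨g5.n, g5.x, g5.l, g5.d⟩, hV', hpot, fun hl w hw hx hd => ?_⟩
      rcases Nat.lt_succ_iff_lt_or_eq.1 hw with h | h
      · exact hsat hl w h hx hd
      · have : w = ⟨j, hj⟩ := Fin.ext h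
        subst this
        exact g6 ⟨hx, hl, hd⟩
    · have hlt := hV'.pot_push g6 g7 g8
      have hne : u ≠ ⟨j, hj⟩ := fun h => by rw [← h] at g8; omega
      refine ⟨g3.trans hv, g1.trans hco, g2.trans hu', rfl, g4.trans hchg, _,
        ⟨g5.n, g5.x, g5.l, g5.d⟩, hV'.push (lt_min g6 (by omega)) (min_le_left _ _)
          (min_le_right _ _) g8, Or.inr ?_, fun hl w hw hx hd => ?_⟩
      · rcases hpot with rfl | hpot
        exacts [hlt, hlt.trans hpot]
      · rw [load_push] at hl
        simp only [hne, if_false, if_true, add_zero] at hl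
        -- `u` is still overloaded after the push, so the push was limited by the arc and not by the
        -- excess: it emptied the arc.
        have hmin : min (X' u ⟨j, hj⟩) (load X' u - μ) = X' u ⟨j, hj⟩ :=
          (min_choice _ _).resolve_right fun h => by rw [h] at hl; omega
        rcases Nat.lt_succ_iff_lt_or_eq.1 hw with h | h
        · refine hsat g7 w h ?_ hd
          have hwj : w ≠ ⟨j, hj⟩ := fun e => by rw [e] at h; simp at h
          simpa [push, hne, hwj] using hx
        · have : w = ⟨j, hj⟩ := Fin.ext h
          subst this
          simp [push, hne, hmin] at hx
  · rintro m' ⟨hco, hu', -, hchg, X', hF', hV', hpot, hsat⟩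
    exact ⟨hco, hu', hchg, X', hF', hV', hpot, fun hl w => hsat hl w w.2⟩

/-- Push from `u` and, if it stays overloaded, relabel it. -/
def visit : Program :=
  .ite (xl vu - vmu)
    (.ite (vn - xd vu)
      (.seq (.assign 12 1) <| .seq pushRow <|
        .ite (xl vu - vmu) (.store 9 vu (xd vu + 1)) .skip)
      .skip)
    .skip

/-- Whenever `chg` is set, the potential falls: either `u` remains overloaded and is relabelled, or
its load has dropped and hence some push took place. -/
theorem visit_does {u : Fin N} (hF : Flow N X d m) (hV : Valid X₀ μ X d)
    (hB : Fits b N X₀ μ c) (hmu : m.mu = μ) (hu : m.u = u) :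
    Does b visit m (N * 14 + 7) fun m' => core m' = core m ∧ m'.u = m.u ∧
      ∃ X' d', Flow N X' d' m' ∧ Valid X₀ μ X' d' ∧
        (m'.chg = m.chg ∧ X' = X ∧ d' = d ∧ (μ < load X u → d u = N) ∨
          m'.chg = 1 ∧ pot μ X' d' < pot μ X d) := by
  refine Does.ite (k := N * 14 + 6) (fun h => ?_) (fun h => Does.skip (k := N * 14 + 5)
    ⟨rfl, rfl, X, d, hF, hV, Or.inl ⟨rfl, rfl, rfl, fun h' => ?_⟩⟩)
  · have hlu : μ < load X u := by
      simp [hu, hmu, hF.l] at h; exact h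
    refine Does.ite (k := N * 14 + 5) (fun h => ?_) (fun h => Does.skip (k := N * 14 + 4)
      ⟨rfl, rfl, X, d, hF, hV, Or.inl ⟨rfl, rfl, rfl, fun h' => ?_⟩⟩)
    · have hdu : d u < N := by
        simp [hu, hF.n, hF.d] at h; exact h
      refine Does.assign_seq (k := N * 14 + 4) 1 rfl (fun _ => ?_) <|
        Does.seq (k₁ := N * 14 + 2) (k₂ := 2) <|
        (pushRow_does (u := u) (X := X) (X₀ := X₀) (μ := μ) (d := d) (c := c) ?_ hV hB
          ?_ ?_).mono le_rfl ?_
      · have := hB.lt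
        rw [abs_one]; omega
      · exact ⟨hF.n, hF.x, hF.l, hF.d⟩
      · exact hmu
      · exact hu
      · rintro m' ⟨hco, hu', hchg, X', hF', hV', hpot, hsat⟩
        have hmu' : m'.mu = μ := (congrArg Mem.mu hco :).trans hmu
        replace hu' : m'.u = u := hu'.trans hu
        refine Does.ite (k := 1) (fun h1 => ?_) (fun h1 => Does.skip (k := 0)
          ⟨hco, hu'.trans hu.symm, X', d, hF', hV', Or.inr ⟨hchg, ?_⟩⟩)
        · have hlu' : μ < load X' u := by
            simp [hu', hmu', hF'.l] at h1; exact h1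
          have hd0 := hV'.d_nonneg u
          have hrel := hV'.relabel hlu' (by simpa using hdu) (hsat hlu')
          refine Does.store (k := 0) u (d u + 1) hu' (by simp [hu', hF'.d]) (fun _ => ?_)
            ⟨hco, hu'.trans hu.symm, X', Function.update d u (d u + 1),
              ⟨hF'.n, hF'.x, hF'.l, fun w => ?_⟩, hrel, Or.inr ⟨hchg, ?_⟩⟩
          · have := hB.lt
            rw [abs_of_nonneg] <;> omega
          · simp only [Mem.setArr, Function.update_apply, hF'.d, Nat.cast_inj, ← Fin.ext_iff]
          · refine (pot_relabel hlu').trans_le ?_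
            rcases hpot with rfl | hpot
            exacts [le_rfl, hpot.le]
        -- `X' = X` is impossible here: `u` was overloaded before the row and no longer is.
        · rcases hpot with rfl | hpot
          · simp [hu', hmu', hF'.l] at h1; omega
          · exact hpot
    · simp [hu, hF.n, hF.d] at h
      have := hV.d_le u
      simp at this
      omega
  · simp [hu, hmu, hF.l] at h
    omega

/-- Visit all vertices. -/
def sweep : Program := .seq (.assign 12 0) (forTo 13 vn visit)

/-- If no visit sets `chg`, assignment and labels were constant throughout the sweep, so the
observations at the individual vertices hold simultaneously. -/
theorem sweep_does (hF : Flow N X d m) (hV : Valid X₀ μ X d)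
    (hB : Fits b N X₀ μ c) (hmu : m.mu = μ) :
    Does b sweep m (N * (N * 14 + 9) + 3) fun m' => core m' = core m ∧
      ∃ X' d', Flow N X' d' m' ∧ Valid X₀ μ X' d' ∧
        (m'.chg = 0 ∧ (∀ u, μ < load X' u → d' u = N) ∨
          m'.chg = 1 ∧ pot μ X' d' < pot μ X d) := by
  refine Does.assign_seq (k := N * (N * 14 + 9) + 2) 0 rfl (fun _ => by simp) <|
    Does.forTo (k := N * 14 + 7) N (fun j m' => core m' = core m ∧ m'.u = j ∧
      ∃ X' d', Flow N X' d' m' ∧ Valid X₀ μ X' d' ∧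
        (m'.chg = 0 ∧ X' = X ∧ d' = d ∧ (∀ u : Fin N, (u : ℕ) < j → μ < load X u → d u = N) ∨
          m'.chg = 1 ∧ pot μ X' d' < pot μ X d))
    ⟨rfl, rfl, X, d, ⟨hF.n, hF.x, hF.l, hF.d⟩, hV, Or.inl ⟨rfl, rfl, rfl, fun _ h => by omega⟩⟩
    (by have := hB.lt; omega) ?_ ?_ ?_
  · rintro j m' ⟨hco, hu, -⟩
    exact ⟨hu, (congrArg Mem.n hco :).trans hF.n⟩
  · rintro j m' hj ⟨hco, hu, X', d', hF', hV', hor⟩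
    refine (visit_does (u := ⟨j, hj⟩) hF' hV' hB ((congrArg Mem.mu hco :).trans hmu) hu).mono
      le_rfl ?_
    rintro m'' ⟨g1, g2, X'', d'', hF'', hV'', hor'⟩
    refine ⟨g2.trans hu, g1.trans hco, rfl, X'', d'', ⟨hF''.n, hF''.x, hF''.l, hF''.d⟩, hV'', ?_⟩
    rcases hor' with ⟨g3, rfl, rfl, g4⟩ | ⟨g3, g4⟩
    · rcases hor with ⟨f1, rfl, rfl, f2⟩ | ⟨f1, f2⟩
      · refine Or.inl ⟨g3.trans f1, rfl, rfl, fun u hu' hl => ?_⟩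
        rcases Nat.lt_succ_iff_lt_or_eq.1 hu' with h | h
        · exact f2 u h hl
        · have : u = ⟨j, hj⟩ := Fin.ext h
          subst this
          exact g4 hl
      · exact Or.inr ⟨g3.trans f1, f2⟩
    · refine Or.inr ⟨g3, ?_⟩
      rcases hor with ⟨f1, rfl, rfl, f2⟩ | ⟨f1, f2⟩
      · exact g4
      · exact g4.trans f2
  · rintro m' ⟨hco, -, X', d', hF', hV', ⟨h1, rfl, rfl, h2⟩ | h⟩
    · exact ⟨hco, X', d', hF', hV', Or.inl ⟨h1, fun u => h2 u u.2⟩⟩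
    · exact ⟨hco, X', d', hF', hV', Or.inr h⟩

/-- Visit all vertices until no overloaded vertex has a label below `n`. -/
def balance : Program := .seq (.assign 12 1) (.loop vchg sweep)

/-- A bound for the number of sweeps. -/
def sweeps (N : ℕ) : ℕ := (N + 1) * (N * (N * N) + N * N) + 1

/-- Each sweep that sets `chg` costs at least one unit of the nonnegative potential; the invariant
`pot + j ≤` initial bound turns this into a bound for the number of rounds. -/
theorem balance_does (hF : Flow N X 0 m) (hV : Valid X₀ μ X 0)
    (hB : Fits b N X₀ μ c) (hmu : m.mu = μ) :
    Does b balance m (sweeps N * (N * (N * 14 + 9) + 4) + 2) fun m' => core m' = core m ∧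
      ∃ X' d', Flow N X' d' m' ∧ Valid X₀ μ X' d' ∧ ∀ u, μ < load X' u → d' u = N := by
  refine Does.assign_seq (k := sweeps N * (N * (N * 14 + 9) + 4) + 1) 1 rfl (fun _ => ?_) <|
    Does.loop (k := N * (N * 14 + 9) + 3) (sweeps N) (fun j m' => core m' = core m ∧
      ∃ X' d', Flow N X' d' m' ∧ Valid X₀ μ X' d' ∧
        (m'.chg = 0 ∧ (∀ u, μ < load X' u → d' u = N) ∨
          m'.chg = 1 ∧ pot μ X' d' + j ≤ (N + 1) * (N * (N * N) + N * N)))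
    ⟨rfl, X, 0, ⟨hF.n, hF.x, hF.l, hF.d⟩, hV, Or.inr ⟨rfl, ?_⟩⟩ ?_ ?_
  · have := hB.lt
    rw [abs_one]; omega
  · have := pot_zero_le μ X
    simp only [Fintype.card_fin] at this
    simpa using this
  · rintro j m' ⟨hco, X', d', hF', hV', hor⟩ hpos
    replace hpos : 0 < m'.chg := hpos
    rcases hor with ⟨h1, -⟩ | ⟨h1, h2⟩
    · omega
    · have h0 := hV'.pot_nonneg
      refine ⟨?_, (sweep_does hF' hV' hB ((congrArg Mem.mu hco :).trans hmu)).mono le_rfl ?_⟩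
      · have : (j : ℤ) < ((sweeps N : ℕ) : ℤ) := by
          unfold sweeps
          push_cast
          omega
        exact_mod_cast this
      · rintro m'' ⟨g1, X'', d'', hF'', hV'', hor'⟩
        refine ⟨g1.trans hco, X'', d'', hF'', hV'', hor'.imp id ?_⟩
        rintro ⟨g2, g3⟩
        exact ⟨g2, by push_cast; omega⟩
  · rintro j m' ⟨hco, X', d', hF', hV', hor⟩ hneg
    replace hneg : m'.chg ≤ 0 := hneg
    rcases hor with ⟨h1, h2⟩ | ⟨h1, h2⟩
    · exact ⟨hco, X', d', hF', hV', h2⟩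
    · omega

end

end DSD

namespace DSD

open RAM Balance

variable {b : ℕ} [NeZero b]

section

variable {N : ℕ} {X₀ X : Fin N → Fin N → ℤ} {μ c : ℤ} {d : Fin N → ℤ} {m : Mem}

/-! ### Extracting a vertex set -/

/-- Test whether there is an overloaded vertex. -/
def checkOver : Program :=
  .seq (.assign 11 0) (forTo 13 vn (.ite (xl vu - vmu) (.assign 11 1) .skip))

theorem checkOver_does (hF : Flow N X d m) (hmu : m.mu = μ) (hN : (N : ℤ) + 1 ≤ 2 ^ b) :
    Does b checkOver m (N * 4 + 3) fun m' => core m' = core m ∧ Flow N X d m' ∧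
      (m'.go = 1 ∧ (∃ u, μ < load X u) ∨ m'.go = 0 ∧ ∀ u, load X u ≤ μ) := by
  refine Does.assign_seq (k := N * 4 + 2) 0 rfl (by simp) <|
    Does.forTo (k := 2) N (fun j m' => core m' = core m ∧ m'.u = j ∧ Flow N X d m' ∧
      (m'.go = 1 ∧ (∃ u, μ < load X u) ∨ m'.go = 0 ∧ ∀ u : Fin N, (u : ℕ) < j → load X u ≤ μ))
    ⟨rfl, rfl, ⟨hF.n, hF.x, hF.l, hF.d⟩, Or.inr ⟨rfl, fun _ h => by omega⟩⟩ (by omega) ?_ ?_ ?_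
  · rintro j m' ⟨-, hu, hF', -⟩
    exact ⟨hu, hF'.n⟩
  · rintro j m' hj ⟨hco, hu, hF', hor⟩
    have hmu' : m'.mu = μ := (congrArg Mem.mu hco :).trans hmu
    have hl : m'.l j = load X ⟨j, hj⟩ := hF'.l ⟨j, hj⟩
    refine Does.ite (k := 1) (fun h => ?_) (fun h => ?_)
    · simp [hu, hmu', hl] at h
      exact Does.assign (k := 0) 1 rfl (fun _ => by rw [abs_one]; omega)
        ⟨hu, hco, rfl, ⟨hF'.n, hF'.x, hF'.l, hF'.d⟩, Or.inl ⟨rfl, _, h⟩⟩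
    · simp [hu, hmu', hl] at h
      refine Does.skip (k := 0) ⟨hu, hco, rfl, ⟨hF'.n, hF'.x, hF'.l, hF'.d⟩, ?_⟩
      rcases hor with hor | ⟨h1, h2⟩
      · exact Or.inl hor
      · refine Or.inr ⟨h1, fun u hu' => ?_⟩
        rcases Nat.lt_succ_iff_lt_or_eq.1 hu' with h' | h'
        · exact h2 u h'
        · have : u = ⟨j, hj⟩ := Fin.ext h'
          rwa [this]
  · rintro m' ⟨hco, -, hF', h | h⟩
    · exact ⟨hco, hF', Or.inl h⟩
    · exact ⟨hco, hF', Or.inr ⟨h.1, fun u => h.2 u u.2⟩⟩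

/-- All labels below `k` occur. -/
def Occupied (d : Fin N → ℤ) (k : ℕ) : Prop := ∀ i < k, ∃ u, d u = (i : ℤ)

/-- Pigeonhole: distinct labels need distinct vertices. -/
theorem Occupied.le {k : ℕ} (h : Occupied d k) : k ≤ N := by
  choose f hf using fun i : Fin k => h i i.2
  have hinj : Function.Injective f := fun i j hij => by
    have h1 := hf i
    rw [hij, hf j] at h1
    exact Fin.ext (by exact_mod_cast h1.symm)
  simpa using Fintype.card_le_of_injective f hinj

theorem Occupied.succ {k : ℕ} (h : Occupied d k) {u : Fin N} (hu : d u = k) :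
    Occupied d (k + 1) := fun i hi => by
  rcases Nat.lt_succ_iff_lt_or_eq.1 hi with h' | rfl
  · exact h i h'
  · exact ⟨u, hu⟩

/-- Increase `k` if it occurs among the labels. -/
def levelPass : Program :=
  forTo 13 vn (.ite (1 - (xd vu - vk) * (xd vu - vk)) (.assign 16 (vk + 1)) .skip)

theorem levelPass_does (hF : Flow N X d m) (hN : (N : ℤ) + 1 ≤ 2 ^ b) {k : ℕ} (hk : m.k = k)
    (hocc : Occupied d k) :
    Does b levelPass m (N * 4 + 2) fun m' => core m' = core m ∧ m'.go = m.go ∧ m'.i = m.i ∧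
      Flow N X d m' ∧ (m'.k = k ∧ (∀ u, d u ≠ k) ∨
        ∃ k' : ℕ, k < k' ∧ m'.k = k' ∧ Occupied d k') := by
  refine Does.forTo (k := 2) N (fun j m' => core m' = core m ∧ m'.u = j ∧ m'.go = m.go ∧
      m'.i = m.i ∧ Flow N X d m' ∧ (m'.k = k ∧ (∀ u : Fin N, (u : ℕ) < j → d u ≠ k) ∨
        ∃ k' : ℕ, k < k' ∧ m'.k = k' ∧ Occupied d k'))
    ⟨rfl, rfl, rfl, rfl, ⟨hF.n, hF.x, hF.l, hF.d⟩, Or.inl ⟨hk, fun _ h => by omega⟩⟩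
    (by omega) ?_ ?_ ?_
  · rintro j m' ⟨-, hu, -, -, hF', -⟩
    exact ⟨hu, hF'.n⟩
  · rintro j m' hj ⟨hco, hu, hgo, hi, hF', hor⟩
    have hd : m'.d j = d ⟨j, hj⟩ := hF'.d ⟨j, hj⟩
    have htest : 0 < (1 - (xd vu - vk) * (xd vu - vk) : Expr).eval m'.enc
        ↔ d ⟨j, hj⟩ = m'.k := by
      simp only [Expr.eval_sub, Expr.eval_mul, Expr.eval_one, one_sub_mul_self_pos]
      simp only [eval_xd, eval_vu, eval_vk, hu, hd]
      omega
    obtain ⟨k₁, hk₁, hocc₁, hle⟩ : ∃ k₁ : ℕ, m'.k = k₁ ∧ Occupied d k₁ ∧ k ≤ k₁ := by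
      rcases hor with h | ⟨k', h1, h2, h3⟩
      · exact ⟨k, h.1, hocc, le_rfl⟩
      · exact ⟨k', h2, h3, h1.le⟩
    refine Does.ite (k := 1) (fun h => ?_) (fun h => ?_)
    · have hd' : d ⟨j, hj⟩ = k₁ := (htest.1 h).trans hk₁
      have hocc' := hocc₁.succ hd'
      refine Does.assign (k := 0) (k₁ + 1) (by simp [hk₁]) (fun _ => ?_)
        ⟨hu, hco, rfl, hgo, hi, ⟨hF'.n, hF'.x, hF'.l, hF'.d⟩,
          Or.inr ⟨k₁ + 1, by omega, by simp, hocc'⟩⟩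
      have := hocc'.le
      rw [abs_of_nonneg] <;> omega
    · refine Does.skip (k := 0) ⟨hu, hco, rfl, hgo, hi, ⟨hF'.n, hF'.x, hF'.l, hF'.d⟩, ?_⟩
      rcases hor with ⟨h1, h2⟩ | h'
      · refine Or.inl ⟨h1, fun u hu' => ?_⟩
        rcases Nat.lt_succ_iff_lt_or_eq.1 hu' with h' | h'
        · exact h2 u h'
        · have : u = ⟨j, hj⟩ := Fin.ext h'
          subst this
          rw [← h1]
          exact fun h' => absurd (htest.2 h') (not_lt.2 h)
      · exact Or.inr h'
  · rintro m' ⟨hco, -, hgo, hi, hF', h | h⟩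
    · exact ⟨hco, hgo, hi, hF', Or.inl ⟨h.1, fun u => h.2 u u.2⟩⟩
    · exact ⟨hco, hgo, hi, hF', Or.inr h⟩

/-- Compute a label that does not occur. -/
def findLevel : Program := .seq (.assign 16 0) (forTo 17 (vn + 1) levelPass)

/-- A pass either finds `k` unused or raises it, possibly several times, with all labels below `k`
in use. -/
theorem findLevel_does (hF : Flow N X d m) (hN : (N : ℤ) + 1 ≤ 2 ^ b) :
    Does b findLevel m ((N + 1) * (N * 4 + 4) + 3) fun m' => core m' = core m ∧ m'.go = m.go ∧
      Flow N X d m' ∧ (∀ u, d u ≠ m'.k) ∧ 0 ≤ m'.k ∧ m'.k ≤ N := by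
  refine Does.assign_seq (k := (N + 1) * (N * 4 + 4) + 2) 0 rfl (by simp) <|
    Does.forTo (k := N * 4 + 2) (N + 1) (fun j m' => core m' = core m ∧ m'.go = m.go ∧ m'.i = j ∧
      Flow N X d m' ∧ ∃ k : ℕ, m'.k = k ∧ Occupied d k ∧ ((∀ u, d u ≠ k) ∨ j ≤ k))
    ⟨rfl, rfl, rfl, ⟨hF.n, hF.x, hF.l, hF.d⟩, 0, rfl, fun _ h => by omega, Or.inr le_rfl⟩
    (by push_cast; omega) ?_ ?_ ?_
  · rintro j m' ⟨-, -, hi, hF', -⟩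
    exact ⟨hi, by simp [hF'.n]⟩
  · rintro j m' hj ⟨hco, hgo, hi, hF', k, hk, hocc, hor⟩
    refine (levelPass_does hF' hN hk hocc).mono le_rfl ?_
    rintro m'' ⟨g1, g2, g3, g4, ⟨g5, g6⟩ | ⟨k', g5, g6, g7⟩⟩
    · exact ⟨g3.trans hi, g1.trans hco, g2.trans hgo, rfl, ⟨g4.n, g4.x, g4.l, g4.d⟩, k, g5, hocc,
        Or.inl g6⟩
    · refine ⟨g3.trans hi, g1.trans hco, g2.trans hgo, rfl, ⟨g4.n, g4.x, g4.l, g4.d⟩, k', g6, g7,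
        Or.inr ?_⟩
      rcases hor with h | h
      · obtain ⟨u, hu⟩ := g7 k g5
        exact absurd hu (h u)
      · omega
  · rintro m' ⟨hco, hgo, -, hF', k, hk, hocc, hor⟩
    have hle := hocc.le
    rw [hk]
    -- After `N + 1` passes the other alternative would give `N + 1 ≤ k`, against `k ≤ N`.
    exact ⟨hco, hgo, hF', hor.resolve_right (by omega), by omega, by omega⟩

/-- Store the indicator vector of the set of the vertices with a label above `k`. -/
def select : Program := forTo 13 vn (.ite (xd vu - vk) (.store 4 vu 1) (.store 4 vu 0))

theorem select_does (hF : Flow N X d m) (hN : (N : ℤ) + 1 ≤ 2 ^ b) :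
    Does b select m (N * 4 + 2) fun m' => core m' = core { m with s := m'.s } ∧ m'.go = m.go ∧
      ∀ u : Fin N, m'.s u = if m.k < d u then 1 else 0 := by
  refine Does.forTo (k := 2) N (fun j m' => core m' = core { m with s := m'.s } ∧ m'.go = m.go ∧
      m'.u = j ∧ m'.k = m.k ∧ m'.d = m.d ∧
      ∀ u : Fin N, (u : ℕ) < j → m'.s u = if m.k < d u then 1 else 0)
    ⟨rfl, rfl, rfl, rfl, rfl, fun _ h => by omega⟩ (by omega) ?_ ?_ ?_
  · rintro j m' ⟨hco, -, hu, -⟩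
    exact ⟨hu, (congrArg Mem.n hco :).trans hF.n⟩
  · rintro j m' hj ⟨hco, hgo, hu, hk, hd, hs⟩
    have hd' : m'.d j = d ⟨j, hj⟩ := by rw [hd]; exact hF.d ⟨j, hj⟩
    have hs' : ∀ t : ℤ, t = (if m.k < d ⟨j, hj⟩ then 1 else 0) → ∀ u : Fin N, (u : ℕ) < j + 1 →
        Function.update m'.s j t u = if m.k < d u then 1 else 0 := by
      intro t ht u hu'
      rw [Function.update_apply]
      split_ifs with h1 h2 h2
      · have : u = ⟨j, hj⟩ := Fin.ext (by exact_mod_cast h1)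
        subst this
        rw [ht, if_pos h2]
      · have : u = ⟨j, hj⟩ := Fin.ext (by exact_mod_cast h1)
        subst this
        rw [ht, if_neg h2]
      · rw [hs u (by have : (u : ℕ) ≠ j := by exact_mod_cast h1
                     omega), if_pos h2]
      · rw [hs u (by have : (u : ℕ) ≠ j := by exact_mod_cast h1
                     omega), if_neg h2]
    have hco' : ∀ f, core { m' with s := f } = core { m with s := f } := fun f =>
      congrArg (fun y : Mem => { y with s := f }) hco
    refine Does.ite (k := 1) (fun h => ?_) (fun h => ?_)
    · simp [hu, hk, hd'] at h
      exact Does.store (k := 0) j 1 hu rfl (fun _ => by rw [abs_one]; omega)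
        ⟨hu, hco' _, hgo, rfl, hk, hd, hs' 1 (by rw [if_pos h])⟩
    · simp [hu, hk, hd'] at h
      exact Does.store (k := 0) j 0 hu rfl (by simp)
        ⟨hu, hco' _, hgo, rfl, hk, hd, hs' 0 (by rw [if_neg (not_lt.2 h)])⟩
  · rintro m' ⟨hco, hgo, -, -, -, hs⟩
    exact ⟨hco, hgo, fun u => hs u u.2⟩

end

/-! ### Evaluation of numerator and denominator -/

/-- The weight `A` of every vertex of `S` plus the weight of all ordered pairs in `S`. -/
def total {N : ℕ} (A : ℤ) (a : Fin N → Fin N → ℤ) (S : Finset (Fin N)) : ℤ :=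
  ∑ u ∈ S, (A + ∑ v ∈ S, a u v)

section

variable {N : ℕ} {A H : ℤ} {a : Fin N → Fin N → ℤ}

theorem total_nonneg (hA : 0 ≤ A) (ha : ∀ u v, 0 ≤ a u v) (S : Finset (Fin N)) :
    0 ≤ total A a S :=
  Finset.sum_nonneg fun u _ => add_nonneg hA (Finset.sum_nonneg fun v _ => ha u v)

theorem total_pos (hA : 0 < A) (ha : ∀ u v, 0 ≤ a u v) {S : Finset (Fin N)} (hS : S.Nonempty) :
    0 < total A a S :=
  Finset.sum_pos (fun u _ => add_pos_of_pos_of_nonneg hA (Finset.sum_nonneg fun v _ => ha u v)) hS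

theorem total_le (hA : 0 ≤ A) (hAH : A ≤ H) (ha : ∀ u v, 0 ≤ a u v) (haH : ∀ u v, a u v ≤ H)
    (S : Finset (Fin N)) : total A a S ≤ N * (H + N * H) := by
  calc total A a S ≤ ∑ u : Fin N, (A + ∑ v ∈ S, a u v) :=
        Finset.sum_le_sum_of_subset_of_nonneg (Finset.subset_univ _) fun u _ _ =>
          add_nonneg hA (Finset.sum_nonneg fun v _ => ha u v)
    _ ≤ ∑ _u : Fin N, (H + N * H) := Finset.sum_le_sum fun u _ => by
        refine add_le_add hAH ?_
        calc ∑ v ∈ S, a u v ≤ ∑ v : Fin N, a u v :=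
              Finset.sum_le_sum_of_subset_of_nonneg (Finset.subset_univ _) fun v _ _ => ha u v
          _ ≤ ∑ _v : Fin N, H := Finset.sum_le_sum fun v _ => haH u v
          _ = N * H := by simp
    _ = N * (H + N * H) := by simp

/-- One row of `total`, in terms of the indicator vector `s` and the array `g`. -/
def rowSum (s g : ℤ → ℤ) (N p j : ℕ) : ℤ :=
  ∑ q ∈ Finset.range j, s p * s q * g (p * N + q)

theorem sum_rowSum {s g : ℤ → ℤ} {S : Finset (Fin N)}
    (hs : ∀ u : Fin N, s u = if u ∈ S then 1 else 0)
    (hg : ∀ u v : Fin N, g (u * N + v) = a u v) :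
    ∑ p ∈ Finset.range N, (s p * A + rowSum s g N p N) = total A a S := by
  rw [← Fin.sum_univ_eq_sum_range (fun p : ℕ => s p * A + rowSum s g N p N), total,
    ← Finset.sum_subset (Finset.subset_univ S)]
  · refine Finset.sum_congr rfl fun u hu => ?_
    rw [rowSum, ← Fin.sum_univ_eq_sum_range (fun q : ℕ => s u * s q * g (u * N + q)),
      ← Finset.sum_subset (Finset.subset_univ S)]
    · rw [hs u, if_pos hu, one_mul]
      congr 1
      exact Finset.sum_congr rfl fun v hv => by rw [hs v, if_pos hv, hg]; ring
    · intro v _ hv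
      rw [hs v, if_neg hv]; ring
  · intro u _ hu
    simp [rowSum, hs u, hu]

end

def evalRow : Program :=
  forTo 14 vn <| .seq (.assign 8 (vP + xs vu * xs vv * xa uv))
    (.assign 9 (vQ + xs vu * xs vv * xb uv))

def evalAll : Program :=
  .seq (.assign 8 0) <| .seq (.assign 9 0) <| forTo 13 vn <|
    .seq (.assign 8 (vP + xs vu * vA)) <| .seq (.assign 9 (vQ + xs vu * vB)) evalRow

section

variable {N : ℕ} {m : Mem} {H : ℤ}

theorem indicator_mul_mem {s t g : ℤ} (hs : s = 0 ∨ s = 1) (ht : t = 0 ∨ t = 1)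
    (hg : 0 ≤ g ∧ g ≤ H) : 0 ≤ s * t * g ∧ s * t * g ≤ H := by
  have := hg.1.trans hg.2
  rcases hs with rfl | rfl <;> rcases ht with rfl | rfl <;> simp [hg, this]

theorem evalRow_does {u : ℕ} (hu : u < N) (hn : m.n = N) (hmu : m.u = u)
    (hs : ∀ p : ℕ, p < N → m.s p = 0 ∨ m.s p = 1)
    (ha : ∀ p q : ℕ, p < N → q < N → 0 ≤ m.a (p * N + q) ∧ m.a (p * N + q) ≤ H)
    (hb : ∀ p q : ℕ, p < N → q < N → 0 ≤ m.b (p * N + q) ∧ m.b (p * N + q) ≤ H)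
    (hP : 0 ≤ m.P) (hQ : 0 ≤ m.Q) (hP' : m.P + N * H ≤ 2 ^ b) (hQ' : m.Q + N * H ≤ 2 ^ b)
    (hN : (N : ℤ) ≤ 2 ^ b) :
    Does b evalRow m (N * 4 + 2) fun m' => core m' = core { m with P := m'.P, Q := m'.Q } ∧
      m'.go = m.go ∧ m'.u = m.u ∧ m'.P = m.P + rowSum m.s m.a N u N ∧
        m'.Q = m.Q + rowSum m.s m.b N u N ∧ 0 ≤ m'.P ∧ 0 ≤ m'.Q ∧
        m'.P ≤ m.P + N * H ∧ m'.Q ≤ m.Q + N * H := by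
  refine Does.forTo (k := 2) N (fun j m' => j ≤ N ∧
      core m' = core { m with P := m'.P, Q := m'.Q } ∧ m'.v = j ∧
      m'.go = m.go ∧ m'.u = m.u ∧ m'.P = m.P + rowSum m.s m.a N u j ∧
        m'.Q = m.Q + rowSum m.s m.b N u j ∧ 0 ≤ m'.P ∧ 0 ≤ m'.Q ∧
        m'.P ≤ m.P + j * H ∧ m'.Q ≤ m.Q + j * H)
    ⟨Nat.zero_le _, rfl, rfl, rfl, rfl, by simp [rowSum], by simp [rowSum], hP, hQ, by simp,
      by simp⟩ hN ?_ ?_ ?_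
  · rintro j m' ⟨-, hco, hv, -⟩
    exact ⟨hv, (congrArg Mem.n hco :).trans hn⟩
  · rintro j m' hj ⟨-, hco, hv, hgo, hu', h1, h2, h3, h4, h5, h6⟩
    have hn' : m'.n = N := (congrArg Mem.n hco :).trans hn
    have hs' : m'.s = m.s := (congrArg Mem.s hco :)
    have ha' : m'.a = m.a := (congrArg Mem.a hco :)
    have hb' : m'.b = m.b := (congrArg Mem.b hco :)
    have ka := indicator_mul_mem (hs u hu) (hs j hj) (ha u j hu hj)
    have kb := indicator_mul_mem (hs u hu) (hs j hj) (hb u j hu hj)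
    have hjN : ((j : ℤ) + 1) * H ≤ N * H := by
      have : (j : ℤ) + 1 ≤ N := by exact_mod_cast hj
      exact mul_le_mul_of_nonneg_right this (ka.1.trans ka.2)
    rw [add_mul, one_mul] at hjN
    set ta := m.s u * m.s j * m.a (u * N + j) with hta
    set tb := m.s u * m.s j * m.b (u * N + j) with htb
    refine Does.assign_seq (k := 1) (m'.P + ta)
      (by simp [hu', hmu, hv, hn', hs', ha', hta]) (fun _ => ?_) <|
      Does.assign (k := 0) (m'.Q + tb)
      (by simp [hu', hmu, hv, hn', hs', hb', htb]) (fun _ => ?_) ⟨hv, hj, ?_⟩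
    · rw [abs_of_nonneg] <;> omega
    · rw [abs_of_nonneg] <;> omega
    · simp only [Mem.setVar]
      refine ⟨congrArg (fun y : Mem => { y with P := m'.P + ta, Q := m'.Q + tb }) hco, by simp, hgo,
        hu', ?_, ?_, by omega, by omega, ?_, ?_⟩
      · rw [h1, rowSum, rowSum, Finset.sum_range_succ]; ring
      · rw [h2, rowSum, rowSum, Finset.sum_range_succ]; ring
      · push_cast; rw [add_mul, one_mul]; omega
      · push_cast; rw [add_mul, one_mul]; omega
  · rintro m' ⟨-, hco, -, hgo, hu', h⟩
    exact ⟨hco, hgo, hu', h⟩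

theorem evalAll_does (hn : m.n = N)
    (hs : ∀ p : ℕ, p < N → m.s p = 0 ∨ m.s p = 1)
    (hA : 0 ≤ m.A ∧ m.A ≤ H) (hB : 0 ≤ m.B ∧ m.B ≤ H)
    (ha : ∀ p q : ℕ, p < N → q < N → 0 ≤ m.a (p * N + q) ∧ m.a (p * N + q) ≤ H)
    (hb : ∀ p q : ℕ, p < N → q < N → 0 ≤ m.b (p * N + q) ∧ m.b (p * N + q) ≤ H)
    (hH : N * (H + N * H) ≤ 2 ^ b) (hN : (N : ℤ) ≤ 2 ^ b) :
    Does b evalAll m (N * (N * 4 + 6) + 4) fun m' =>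
      core m' = core { m with P := m'.P, Q := m'.Q } ∧ m'.go = m.go ∧
      m'.P = ∑ p ∈ Finset.range N, (m.s p * m.A + rowSum m.s m.a N p N) ∧
      m'.Q = ∑ p ∈ Finset.range N, (m.s p * m.B + rowSum m.s m.b N p N) := by
  refine Does.assign_seq (k := N * (N * 4 + 6) + 3) 0 rfl (by simp) <|
    Does.assign_seq (k := N * (N * 4 + 6) + 2) 0 rfl (by simp) <|
    Does.forTo (k := N * 4 + 4) N (fun j m' => core m' = core { m with P := m'.P, Q := m'.Q } ∧
      m'.go = m.go ∧ m'.u = j ∧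
      m'.P = ∑ p ∈ Finset.range j, (m.s p * m.A + rowSum m.s m.a N p N) ∧
      m'.Q = ∑ p ∈ Finset.range j, (m.s p * m.B + rowSum m.s m.b N p N) ∧
      0 ≤ m'.P ∧ 0 ≤ m'.Q ∧ m'.P ≤ j * (H + N * H) ∧ m'.Q ≤ j * (H + N * H))
    ⟨rfl, rfl, rfl, by simp, by simp, by simp, by simp, by simp, by simp⟩ hN ?_ ?_ ?_
  · rintro j m' ⟨hco, -, hu, -⟩
    exact ⟨hu, (congrArg Mem.n hco :).trans hn⟩
  · rintro j m' hj ⟨hco, hgo, hu, h1, h2, h3, h4, h5, h6⟩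
    have hn' : m'.n = N := (congrArg Mem.n hco :).trans hn
    have hs' : m'.s = m.s := (congrArg Mem.s hco :)
    have hA' : m'.A = m.A := (congrArg Mem.A hco :)
    have hB' : m'.B = m.B := (congrArg Mem.B hco :)
    have ha' : m'.a = m.a := (congrArg Mem.a hco :)
    have hb' : m'.b = m.b := (congrArg Mem.b hco :)
    have kA : 0 ≤ m.s j * m.A ∧ m.s j * m.A ≤ H := by
      simpa using indicator_mul_mem (hs j hj) (Or.inr rfl) hA
    have kB : 0 ≤ m.s j * m.B ∧ m.s j * m.B ≤ H := by
      simpa using indicator_mul_mem (hs j hj) (Or.inr rfl) hB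
    have hH0 := hA.1.trans hA.2
    have hNH : 0 ≤ N * H := by positivity
    have hjN : ((j : ℤ) + 1) * (H + N * H) ≤ N * (H + N * H) := by
      have : (j : ℤ) + 1 ≤ N := by exact_mod_cast hj
      exact mul_le_mul_of_nonneg_right this (by omega)
    rw [add_mul, one_mul] at hjN
    refine Does.assign_seq (k := N * 4 + 3) (m'.P + m.s j * m.A) (by simp [hu, hs', hA'])
      (fun _ => ?_) ?_
    · rw [abs_of_nonneg] <;> omega
    refine Does.assign_seq (k := N * 4 + 2) (m'.Q + m.s j * m.B) (by simp [hu, hs', hB'])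
      (fun _ => ?_) ?_
    · rw [abs_of_nonneg] <;> omega
    simp only [Mem.setVar]
    refine (evalRow_does (H := H)
      (m := { m' with P := m'.P + m.s j * m.A, Q := m'.Q + m.s j * m.B }) hj hn' hu (by simpa only [hs'] using hs)
      (by simpa only [ha'] using ha) (by simpa only [hb'] using hb) (add_nonneg h3 kA.1)
      (add_nonneg h4 kB.1) ?_ ?_ hN).mono le_rfl ?_
    · simp only; omega
    · simp only; omega
    rintro m'' ⟨g1, g2, g3, g4, g5, g6, g7, g8, g9⟩
    simp only [hs', ha', hb'] at g4 g5 g8 g9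
    refine ⟨g3.trans hu, g1.trans
      (congrArg (fun y : Mem => { y with P := m''.P, Q := m''.Q }) hco), g2.trans hgo, by simp, ?_⟩
    refine ⟨?_, ?_, g6, g7, ?_, ?_⟩
    · rw [g4, h1, Finset.sum_range_succ, add_assoc]
    · rw [g5, h2, Finset.sum_range_succ, add_assoc]
    · push_cast; rw [add_mul, one_mul]; omega
    · push_cast; rw [add_mul, one_mul]; omega
  · rintro m' ⟨hco, hgo, -, h1, h2, -⟩
    exact ⟨hco, hgo, h1, h2⟩

end

end DSD

namespace DSD

open RAM Balance

/-! ### Newton's method -/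

/-- One iteration of Newton's method. -/
def newtonStep : Program :=
  .seq (.assign 10 (vP * vB - vQ * vA)) <| .seq initAll <| .seq balance <| .seq checkOver <|
    .ite vgo (.seq findLevel <| .seq select evalAll) .skip

/-- The number of elementary commands of one iteration. -/
def stepCount (N : ℕ) : ℕ :=
  (N * (N * 4 + 6) + 2) + (sweeps N * (N * (N * 14 + 9) + 4) + 2) + (N * 4 + 3) +
    ((N + 1) * (N * 4 + 4) + 3) + (N * 4 + 2) + (N * (N * 4 + 6) + 4) + 2

/-- The part of the memory that Newton's method does not change: an instance with integral
weights. -/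
structure Holds {N : ℕ} (A B : ℤ) (a r : Fin N → Fin N → ℤ) (m : Mem) : Prop where
  n : m.n = N
  A : m.A = A
  B : m.B = B
  a : ∀ u v : Fin N, m.a (u * N + v) = a u v
  b : ∀ u v : Fin N, m.b (u * N + v) = r u v

/-- The current solution and its value. -/
structure Current {N : ℕ} (A B : ℤ) (a r : Fin N → Fin N → ℤ) (S : Finset (Fin N)) (m : Mem) :
    Prop where
  s : ∀ u : Fin N, m.s u = if u ∈ S then 1 else 0
  P : m.P = total A a S
  Q : m.Q = total B r S

/-- The hypotheses on the integral weights: bounds by `2 ^ h`, and the promise that the reward of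
every edge is at least the maximum ratio times its risk. -/
structure Admissible {N : ℕ} (h : ℕ) (A B : ℤ) (a r : Fin N → Fin N → ℤ) : Prop where
  h_pos : 1 ≤ h
  N_le : (N : ℤ) ≤ 2 ^ h
  A_nonneg : 0 ≤ A
  A_le : A ≤ 2 ^ h
  B_pos : 0 < B
  B_le : B ≤ 2 ^ h
  a_nonneg : ∀ u v, 0 ≤ a u v
  a_le : ∀ u v, a u v ≤ 2 ^ h
  r_nonneg : ∀ u v, 0 ≤ r u v
  r_le : ∀ u v, r u v ≤ 2 ^ h
  promise : ∀ S : Finset (Fin N), S.Nonempty →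
    ∀ u v, total A a S * r u v ≤ total B r S * a u v

section

variable {N h : ℕ} {A B : ℤ} {a r : Fin N → Fin N → ℤ} {m : Mem}

theorem Holds.of_core {m' : Mem} (hm : Holds A B a r m)
    (h : ∃ s P Q mu, core m' = core { m with s := s, P := P, Q := Q, mu := mu }) :
    Holds A B a r m' := by
  obtain ⟨s, P, Q, mu, h⟩ := h
  have h1 : m'.n = m.n := (congrArg Mem.n h :)
  have h2 : m'.A = m.A := (congrArg Mem.A h :)
  have h3 : m'.B = m.B := (congrArg Mem.B h :)
  have h4 : m'.a = m.a := (congrArg Mem.a h :)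
  have h5 : m'.b = m.b := (congrArg Mem.b h :)
  exact ⟨h1.trans hm.n, h2.trans hm.A, h3.trans hm.B, fun u v => by rw [h4, hm.a],
    fun u v => by rw [h5, hm.b]⟩

theorem two_pow_mul_two_pow (p q : ℕ) : (2 : ℤ) ^ p * 2 ^ q = 2 ^ (p + q) := (pow_add 2 p q).symm

theorem two_pow_le_two_pow {p q : ℕ} (h : p ≤ q) : (2 : ℤ) ^ p ≤ 2 ^ q :=
  pow_le_pow_right₀ (by norm_num) h

/-! ### Sizes of the numbers in Newton's method -/

namespace Admissible

theorem capacity (hA : Admissible h A B a r) :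
    (N : ℤ) * (2 ^ h + N * 2 ^ h) ≤ 2 ^ (4 * h) := by
  have h1 := hA.h_pos
  have h2 := hA.N_le
  calc (N : ℤ) * (2 ^ h + N * 2 ^ h) ≤ 2 ^ h * (2 ^ h + 2 ^ h * 2 ^ h) := by gcongr
    _ ≤ 2 ^ h * (2 ^ (2 * h) + 2 ^ (2 * h)) := by
        rw [two_pow_mul_two_pow h h, ← two_mul h]
        have := two_pow_le_two_pow (show h ≤ 2 * h by omega)
        gcongr
    _ = 2 ^ (3 * h + 1) := by ring
    _ ≤ 2 ^ (4 * h) := two_pow_le_two_pow (by omega)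

theorem total_a_le (hA : Admissible h A B a r) (S : Finset (Fin N)) :
    total A a S ≤ 2 ^ (4 * h) :=
  (total_le hA.A_nonneg hA.A_le hA.a_nonneg hA.a_le S).trans hA.capacity

theorem total_r_le (hA : Admissible h A B a r) (S : Finset (Fin N)) :
    total B r S ≤ 2 ^ (4 * h) :=
  (total_le hA.B_pos.le hA.B_le hA.r_nonneg hA.r_le S).trans hA.capacity

theorem total_a_nonneg (hA : Admissible h A B a r) (S : Finset (Fin N)) : 0 ≤ total A a S :=
  total_nonneg hA.A_nonneg hA.a_nonneg S

theorem total_r_nonneg (hA : Admissible h A B a r) (S : Finset (Fin N)) : 0 ≤ total B r S :=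
  total_nonneg hA.B_pos.le hA.r_nonneg S

/-- The assignment from which the balancing phase starts. -/
theorem x₀_bounds (hA : Admissible h A B a r) {S : Finset (Fin N)} (hS : S.Nonempty)
    (u v : Fin N) : 0 ≤ total B r S * a u v - total A a S * r u v ∧
      total B r S * a u v - total A a S * r u v ≤ 2 ^ (5 * h) := by
  have h1 := hA.promise S hS u v
  have h2 : total B r S * a u v ≤ 2 ^ (4 * h) * 2 ^ h :=
    mul_le_mul (hA.total_r_le S) (hA.a_le u v) (hA.a_nonneg u v) (by positivity)
  have h3 : 0 ≤ total A a S * r u v := mul_nonneg (hA.total_a_nonneg S) (hA.r_nonneg u v)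
  rw [two_pow_mul_two_pow, show 4 * h + h = 5 * h by ring] at h2
  omega

theorem abs_target_le (hA : Admissible h A B a r) (S : Finset (Fin N)) :
    |total A a S * B - total B r S * A| ≤ 2 ^ (5 * h) := by
  have h2 : total A a S * B ≤ 2 ^ (4 * h) * 2 ^ h :=
    mul_le_mul (hA.total_a_le S) hA.B_le hA.B_pos.le (by positivity)
  have h3 : total B r S * A ≤ 2 ^ (4 * h) * 2 ^ h :=
    mul_le_mul (hA.total_r_le S) hA.A_le hA.A_nonneg (by positivity)
  have h4 : 0 ≤ total A a S * B := mul_nonneg (hA.total_a_nonneg S) hA.B_pos.le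
  have h5 : 0 ≤ total B r S * A := mul_nonneg (hA.total_r_nonneg S) hA.A_nonneg
  rw [two_pow_mul_two_pow, show 4 * h + h = 5 * h by ring] at h2 h3
  rw [abs_le]
  omega

theorem N_add_one_le (hA : Admissible h A B a r) : (N : ℤ) + 1 ≤ 2 ^ (8 * h) := by
  have h1 := hA.N_le
  have h2 := two_pow_le_two_pow (show h + 1 ≤ 8 * h by have := hA.h_pos; omega)
  have h3 : (1 : ℤ) ≤ 2 ^ h := one_le_pow₀ (by norm_num)
  rw [pow_succ] at h2
  omega

/-- The two orders of a pair contribute `2 * 2 ^ (5 * h)`. Loads are then at most `2 ^ (6 * h + 1)`,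
the target at most `2 ^ (5 * h)`, and `8 * h` bits hold their sum since `h ≥ 1`. -/
theorem fits (hA : Admissible h A B a r) {S : Finset (Fin N)} (hS : S.Nonempty) :
    Fits (8 * h) N (fun u v => total B r S * a u v - total A a S * r u v)
      (total A a S * B - total B r S * A) (2 * 2 ^ (5 * h)) where
  le u v := by
    have h1 := (hA.x₀_bounds hS u v).2
    have h2 := (hA.x₀_bounds hS v u).2
    linarith
  mul_le := by
    have h1 := hA.abs_target_le S
    have h2 : (N : ℤ) * (2 * 2 ^ (5 * h)) ≤ 2 ^ h * (2 * 2 ^ (5 * h)) := by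
      have := hA.N_le
      gcongr
    have h3 : (2 : ℤ) ^ h * (2 * 2 ^ (5 * h)) = 2 ^ (6 * h + 1) := by ring
    have h4 := two_pow_le_two_pow (show 5 * h ≤ 6 * h + 1 by omega)
    have h5 := two_pow_le_two_pow (show 6 * h + 1 + 1 ≤ 8 * h by have := hA.h_pos; omega)
    rw [pow_succ _ (6 * h + 1)] at h5
    linarith
  lt := hA.N_add_one_le

end Admissible

/-- With `q` replaced by the pair of integers `total A a S` and `total B r S`, Newton's inner
objective, multiplied by `total B r S`, is a gain with target `μ`. -/
theorem gain_eq (S T : Finset (Fin N)) :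
    gain (fun u v => total B r S * a u v - total A a S * r u v)
      (total A a S * B - total B r S * A) T
      = total B r S * total A a T - total A a S * total B r T := by
  unfold gain
  rw [total.eq_def A a T, total.eq_def B r T]
  simp only [Finset.sum_sub_distrib, Finset.sum_add_distrib, Finset.sum_const, nsmul_eq_mul,
    ← Finset.mul_sum]
  ring

theorem extract_does {X₀ X : Fin N → Fin N → ℤ} {μ : ℤ} {d : Fin N → ℤ}
    (hA : Admissible h A B a r) (hm : Holds A B a r m) (hF : Flow N X d m) (hV : Valid X₀ μ X d)
    (hgo : m.go = 1) (hex : ∃ u, μ < load X u) (hdone : ∀ u, μ < load X u → d u = N) :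
    haveI : NeZero (8 * h) := ⟨by have := hA.h_pos; omega⟩
    Does (8 * h) (.seq findLevel <| .seq select evalAll) m
      (((N + 1) * (N * 4 + 4) + 3) + ((N * 4 + 2) + (N * (N * 4 + 6) + 4)))
      fun m' => Holds A B a r m' ∧ m'.go = 1 ∧ ∃ S' : Finset (Fin N), S'.Nonempty ∧
        Current A B a r S' m' ∧ 0 < gain X₀ μ S' ∧ ∀ T, gain X₀ μ T ≤ gain X₀ μ S' := by
  have : NeZero (8 * h) := ⟨by have := hA.h_pos; omega⟩
  have hN := hA.N_add_one_le
  have hdone' : ∀ u, μ < load X u → d u = Fintype.card (Fin N) := by simpa using hdone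
  refine Does.seq <| (findLevel_does hF hN).mono le_rfl ?_
  rintro m₁ ⟨hc₁, hg₁, hF₁, hk, hk0, hkN⟩
  refine Does.seq <| (select_does hF₁ hN).mono le_rfl ?_
  rintro m₂ ⟨hc₂, hg₂, hs⟩
  have hm₁ : Holds A B a r m₁ := hm.of_core ⟨_, _, _, _, hc₁⟩
  have hm₂ : Holds A B a r m₂ := hm₁.of_core ⟨_, _, _, _, hc₂⟩
  set S' : Finset (Fin N) := {u | m₁.k < d u} with hS'
  have hs' : ∀ u : Fin N, m₂.s u = if u ∈ S' then 1 else 0 := fun u => by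
    rw [hs u, hS']; simp
  have hkN' : m₁.k ≤ Fintype.card (Fin N) := by simpa using hkN
  have hcap := hA.capacity.trans (two_pow_le_two_pow (show 4 * h ≤ 8 * h by omega))
  refine (evalAll_does (H := 2 ^ h) hm₂.n (fun p hp => ?_) (by rw [hm₂.A]; exact ⟨hA.A_nonneg, hA.A_le⟩)
    (by rw [hm₂.B]; exact ⟨hA.B_pos.le, hA.B_le⟩) (fun p q hp hq => ?_) (fun p q hp hq => ?_)
    hcap (by omega)).mono le_rfl ?_
  · have := hs' ⟨p, hp⟩
    simp only at this
    rw [this]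
    split_ifs <;> simp
  · have := hm₂.a ⟨p, hp⟩ ⟨q, hq⟩
    simp only at this
    rw [this]
    exact ⟨hA.a_nonneg _ _, hA.a_le _ _⟩
  · have := hm₂.b ⟨p, hp⟩ ⟨q, hq⟩
    simp only at this
    rw [this]
    exact ⟨hA.r_nonneg _ _, hA.r_le _ _⟩
  rintro m₃ ⟨hc₃, hg₃, hP, hQ⟩
  have hpos := hV.gain_level_pos hdone' hk hk0 hkN' hex
  refine ⟨hm₂.of_core ⟨_, _, _, _, hc₃⟩, hg₃.trans (hg₂.trans (hg₁.trans hgo)), S', ?_,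
    ⟨?_, ?_, ?_⟩, hpos, hV.gain_le_level hdone' hk hk0 hkN'⟩
  -- The empty set has gain `0`, whereas the selected set has positive gain.
  · rw [Finset.nonempty_iff_ne_empty]
    intro he
    rw [← hS', he] at hpos
    simp [gain] at hpos
  · have : m₃.s = m₂.s := (congrArg Mem.s hc₃ :)
    rw [this]
    exact hs'
  · rw [hP, hm₂.A, sum_rowSum hs' hm₂.a]
  · rw [hQ, hm₂.B, sum_rowSum hs' hm₂.b]

/-- Initially both endpoints of an edge get its full weight, matching the count over ordered pairs
in `total`; the promise makes this start valid with all labels zero. Without an overloaded vertex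
after balancing no gain is positive; otherwise a level set is a maximizer. -/
theorem newtonStep_does (hA : Admissible h A B a r) {S : Finset (Fin N)} (hS : S.Nonempty)
    (hm : Holds A B a r m) (hcur : Current A B a r S m) :
    haveI : NeZero (8 * h) := ⟨by have := hA.h_pos; omega⟩
    Does (8 * h) newtonStep m (stepCount N) fun m' => Holds A B a r m' ∧
      ((m'.go = 1 ∧ ∃ S' : Finset (Fin N), S'.Nonempty ∧ Current A B a r S' m' ∧
        0 < total B r S * total A a S' - total A a S * total B r S' ∧
        ∀ T, total B r S * total A a T - total A a S * total B r T
          ≤ total B r S * total A a S' - total A a S * total B r S') ∨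
      (m'.go = 0 ∧ Current A B a r S m' ∧
        ∀ T, total B r S * total A a T - total A a S * total B r T ≤ 0)) := by
  have : NeZero (8 * h) := ⟨by have := hA.h_pos; omega⟩
  set X₀ : Fin N → Fin N → ℤ := fun u v => total B r S * a u v - total A a S * r u v with hX₀
  set μ : ℤ := total A a S * B - total B r S * A with hμ
  have hB := hA.fits hS
  rw [← hX₀, ← hμ] at hB
  simp only [← gain_eq, ← hX₀, ← hμ]
  refine Does.mono (k := (N * (N * 4 + 6) + 2) + ((sweeps N * (N * (N * 14 + 9) + 4) + 2) +
    ((N * 4 + 3) + (((N + 1) * (N * 4 + 4) + 3) + ((N * 4 + 2) + (N * (N * 4 + 6) + 4)) + 1))) + 1)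
    ?_ (by unfold stepCount; omega) fun _ h => h
  refine Does.assign_seq μ (by simp [hcur.P, hcur.Q, hm.A, hm.B, hμ]) (fun _ => ?_) ?_
  · exact (hA.abs_target_le S).trans (two_pow_le_two_pow (by omega))
  simp only [Mem.setVar]
  have hx : ∀ p q (hp : p < N) (hq : q < N),
      x₀ { m with mu := μ } N p q = X₀ ⟨p, hp⟩ ⟨q, hq⟩ := fun p q hp hq => by
    have h1 := hm.a ⟨p, hp⟩ ⟨q, hq⟩
    have h2 := hm.b ⟨p, hp⟩ ⟨q, hq⟩
    simp only at h1 h2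
    simp only [x₀, h1, h2, hcur.P, hcur.Q, hX₀]
  refine Does.seq <| (initAll_does (m := { m with mu := μ }) (N := N) (c := 2 ^ (5 * h)) hm.n
    (fun p q hp hq => ?_) ?_ ?_).mono le_rfl ?_
  · rw [hx p q hp hq]
    exact hA.x₀_bounds hS _ _
  · have h1 := hB.mul_le
    have h2 := abs_nonneg μ
    have h3 : (0 : ℤ) ≤ N * 2 ^ (5 * h) := by positivity
    linarith
  · have := hA.N_add_one_le
    omega
  rintro m₁ ⟨hc₁, h1, h2, h3⟩
  have hm₁ : Holds A B a r m₁ := hm.of_core ⟨_, _, _, _, hc₁⟩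
  have hF₁ : Flow N X₀ 0 m₁ := ⟨hm₁.n, fun u v => by rw [h1 u v u.2 v.2, hx u v u.2 v.2],
    fun u => by
      rw [h2 u u.2, ← Fin.sum_univ_eq_sum_range (fun q => x₀ { m with mu := μ } N u q)]
      exact Finset.sum_congr rfl fun v _ => hx u v u.2 v.2,
    fun u => h3 u u.2⟩
  have hV₁ : Valid X₀ μ X₀ 0 := ⟨fun u v => (hA.x₀_bounds hS u v).1, fun _ _ => rfl,
    fun _ => le_rfl, fun _ => by simp, fun _ _ _ => by simp, fun _ _ => rfl⟩
  have hmu₁ : m₁.mu = μ := (congrArg Mem.mu hc₁ :)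
  refine Does.seq <| (balance_does hF₁ hV₁ hB hmu₁).mono le_rfl ?_
  rintro m₂ ⟨hc₂, X, d, hF₂, hV₂, hdone⟩
  refine Does.seq <| (checkOver_does hF₂ ((congrArg Mem.mu hc₂ :).trans hmu₁)
    hA.N_add_one_le).mono le_rfl ?_
  rintro m₃ ⟨hc₃, hF₃, hor⟩
  have hc : core m₃ = core { m with mu := μ } := hc₃.trans (hc₂.trans hc₁)
  have hm₃ : Holds A B a r m₃ := hm.of_core ⟨_, _, _, _, hc⟩
  refine Does.ite (fun hgo => ?_) (fun hgo => ?_)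
  · replace hgo : 0 < m₃.go := hgo
    rcases hor with ⟨hg, hex⟩ | ⟨hg, -⟩
    · refine (extract_does hA hm₃ hF₃ hV₂ hg hex hdone).mono le_rfl ?_
      rintro m₄ ⟨g1, g2, g3⟩
      exact ⟨g1, Or.inl ⟨g2, g3⟩⟩
    · omega
  · replace hgo : m₃.go ≤ 0 := hgo
    rcases hor with ⟨hg, -⟩ | ⟨hg, hle⟩
    · omega
    · refine Does.skip (k := _) ⟨hm₃, Or.inr ⟨hg, ⟨?_, ?_, ?_⟩, hV₂.gain_nonpos hle⟩⟩
      · have : m₃.s = m.s := (congrArg Mem.s hc :)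
        rw [this]
        exact hcur.s
      · exact (congrArg Mem.P hc :).trans hcur.P
      · exact (congrArg Mem.Q hc :).trans hcur.Q

theorem newton_does (hA : Admissible h A B a r) {S : Finset (Fin N)} (hS : S.Nonempty)
    (hm : Holds A B a r m) (hcur : Current A B a r S m) (hgo : m.go = 1) :
    haveI : NeZero (8 * h) := ⟨by have := hA.h_pos; omega⟩
    Does (8 * h) (.loop vgo newtonStep) m ((8 * h + 2) * (stepCount N + 1) + 1) fun m' =>
      ∃ S' : Finset (Fin N), S'.Nonempty ∧ (∀ u : Fin N, m'.s u = if u ∈ S' then 1 else 0) ∧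
        ∀ T, total A a T * total B r S' ≤ total A a S' * total B r T := by
  have : NeZero (8 * h) := ⟨by have := hA.h_pos; omega⟩
  let Nf : { T : Finset (Fin N) // T.Nonempty } → ℤ := fun T => total A a T
  let Df : { T : Finset (Fin N) // T.Nonempty } → ℤ := fun T => total B r T
  refine Does.loop (8 * h + 2) (fun j m' => Holds A B a r m' ∧
    ∃ S' : { T : Finset (Fin N) // T.Nonempty }, Current A B a r S' m' ∧
      (m'.go = 1 ∧ Newton.Progress Nf Df (2 ^ (4 * h)) j S' ∨
        m'.go = 0 ∧ ∀ T, total B r S' * total A a T - total A a S' * total B r T ≤ 0))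
    ⟨hm, ⟨S, hS⟩, hcur, Or.inl ⟨hgo, Or.inl rfl⟩⟩ ?_ ?_
  · rintro j m' ⟨hm', S', hcur', hor⟩ hpos
    replace hpos : 0 < m'.go := hpos
    rcases hor with ⟨-, hprog⟩ | ⟨h0, -⟩
    -- `Progress.lt` with `m = 4 * h`, the exponent that bounds numerators and denominators, gives
    -- `j < 8 * h + 2`.
    · refine ⟨by have := hprog.lt; omega, (newtonStep_does hA S'.2 hm' hcur').mono le_rfl ?_⟩
      rintro m'' ⟨hm'', ⟨g1, S'', hS'', hcur'', g2, g3⟩ | ⟨g1, hcur'', g2⟩⟩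
      · refine ⟨hm'', ⟨S'', hS''⟩, hcur'', Or.inl ⟨g1, ?_⟩⟩
        exact Newton.Progress.next (N := Nf) (D := Df) (fun T => hA.total_a_nonneg T) (fun T => hA.total_a_le T)
          (fun T => total_pos hA.B_pos hA.r_nonneg T.2) (fun T => hA.total_r_le T) hprog g2
          (fun T => g3 T)
      · exact ⟨hm'', S', hcur'', Or.inr ⟨g1, g2⟩⟩
    · omega
  · rintro j m' ⟨hm', S', hcur', hor⟩ hneg
    replace hneg : m'.go ≤ 0 := hneg
    rcases hor with ⟨h1, -⟩ | ⟨-, hopt⟩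
    · omega
    · refine ⟨S', S'.2, hcur'.s, fun T => ?_⟩
      have := hopt T
      linarith

end

end DSD

namespace DSD

open RAM Balance

/-! ### Making the weights integral -/

def xpn (i : Expr) : Expr := .get 0 i
def xpd (i : Expr) : Expr := .get 1 i
def xnn (i : Expr) : Expr := .get 2 i
def xnd (i : Expr) : Expr := .get 3 i

/-- Multiply all denominators. -/
def commonDen : Program :=
  .seq (.assign 5 (.var 2 * .var 4)) <|
    forTo 17 (vn * vn) (.ite (xpd vi) (.assign 5 (vW * (xpd vi * xnd vi))) .skip)

/-- Scale all weights by the common denominator. -/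
def scale : Program :=
  forTo 17 (vn * vn) (.seq (.store 5 vi (xpn vi * (vW / xpd vi)))
    (.store 6 vi (xnn vi * (vW / xnd vi))))

/-- Scale the parameters, and start with the first vertex. -/
def startVertex : Program :=
  .seq (.assign 6 (2 * (.var 1 * (vW / .var 2)))) <|
  .seq (.assign 7 (2 * (.var 3 * (vW / .var 4)))) <|
  .seq (.store 4 0 1) <| .seq (.assign 8 vA) <| .seq (.assign 9 vB) <| .assign 11 1

/-- The bounds on the input. -/
structure Input (L N : ℕ) (m : Mem) : Prop where
  N_le : N ≤ L
  N_pos : 1 ≤ N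
  n : m.n = N
  l1n : 0 ≤ m.l1n ∧ m.l1n ≤ 2 ^ L
  l1d : 0 < m.l1d ∧ m.l1d ≤ 2 ^ L
  l2n : 0 < m.l2n ∧ m.l2n ≤ 2 ^ L
  l2d : 0 < m.l2d ∧ m.l2d ≤ 2 ^ L
  wpn : ∀ k : ℕ, k < N * N → 0 ≤ m.wpn k ∧ m.wpn k ≤ 2 ^ L
  wnn : ∀ k : ℕ, k < N * N → 0 ≤ m.wnn k ∧ m.wnn k ≤ 2 ^ L
  wpd : ∀ k : ℕ, k < N * N → 0 ≤ m.wpd k ∧ m.wpd k ≤ 2 ^ L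
  wnd : ∀ k : ℕ, k < N * N → 0 ≤ m.wnd k ∧ m.wnd k ≤ 2 ^ L
  pos_iff : ∀ k : ℕ, k < N * N → (0 < m.wpd k ↔ 0 < m.wnd k)

/-- The contribution of the cell `k` to the common denominator. -/
def denFactor (m : Mem) (k : ℕ) : ℤ := if 0 < m.wpd k then m.wpd k * m.wnd k else 1

/-- The product of the denominators of the parameters and of the first `j` cells. -/
def denProd (m : Mem) (j : ℕ) : ℤ := m.l1d * m.l2d * ∏ k ∈ Finset.range j, denFactor m k

section

variable {L N : ℕ} {m : Mem}

theorem Input.L_pos (h : Input L N m) : 1 ≤ L := h.N_pos.trans h.N_le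

theorem Input.denFactor_bounds (h : Input L N m) {k : ℕ} (hk : k < N * N) :
    0 < denFactor m k ∧ denFactor m k ≤ 2 ^ (2 * L) := by
  unfold denFactor
  split_ifs with h1
  · have h2 := (h.pos_iff k hk).1 h1
    refine ⟨mul_pos h1 h2, ?_⟩
    rw [two_mul, pow_add]
    exact mul_le_mul (h.wpd k hk).2 (h.wnd k hk).2 h2.le (by positivity)
  · exact ⟨one_pos, one_le_pow₀ (by norm_num)⟩

/-- The parameters contribute `2 * L` bits and each of at most `L * L` cells another `2 * L`. Both
cells of an edge are multiplied in, which is wasteful but harmless. -/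
theorem Input.denProd_bounds (h : Input L N m) {j : ℕ} (hj : j ≤ N * N) :
    0 < denProd m j ∧ denProd m j ≤ 2 ^ (4 * L ^ 3) := by
  have h1 : ∀ k ∈ Finset.range j, 0 < denFactor m k ∧ denFactor m k ≤ 2 ^ (2 * L) :=
    fun k hk => h.denFactor_bounds (by simp at hk; omega)
  have h2 : 0 < ∏ k ∈ Finset.range j, denFactor m k := Finset.prod_pos fun k hk => (h1 k hk).1
  have h3 : ∏ k ∈ Finset.range j, denFactor m k ≤ (2 ^ (2 * L)) ^ j := by
    simpa using Finset.prod_le_prod (fun k hk => (h1 k hk).1.le) fun k hk => (h1 k hk).2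
  refine ⟨mul_pos (mul_pos h.l1d.1 h.l2d.1) h2, ?_⟩
  calc denProd m j ≤ 2 ^ L * 2 ^ L * (2 ^ (2 * L)) ^ j :=
        mul_le_mul (mul_le_mul h.l1d.2 h.l2d.2 h.l2d.1.le (by positivity)) h3 h2.le
          (by positivity)
    _ = 2 ^ (2 * L + 2 * L * j) := by rw [← pow_mul, ← pow_add, ← pow_add]; ring_nf
    _ ≤ 2 ^ (4 * L ^ 3) := by
        refine two_pow_le_two_pow ?_
        have h4 : j ≤ L * L := hj.trans (Nat.mul_le_mul h.N_le h.N_le)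
        have h5 : 2 * L * j ≤ 2 * L * (L * L) := Nat.mul_le_mul_left _ h4
        have h6 : 2 * L ≤ 2 * L * (L * L) := Nat.le_mul_of_pos_right _
          (Nat.mul_pos h.L_pos h.L_pos)
        calc 2 * L + 2 * L * j ≤ 2 * L * (L * L) + 2 * L * (L * L) := by omega
          _ = 4 * L ^ 3 := by ring

theorem Input.cube (h : Input L N m) : L ≤ L ^ 3 := by
  have := h.L_pos
  calc L = L ^ 1 := (pow_one L).symm
    _ ≤ L ^ 3 := Nat.pow_le_pow_right this (by norm_num)

theorem Input.sq_le (h : Input L N m) : ((N * N : ℕ) : ℤ) ≤ 2 ^ (48 * L ^ 3) := by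
  have h1 : N ≤ 2 ^ L := h.N_le.trans Nat.lt_two_pow_self.le
  have h2 : N * N ≤ 2 ^ (2 * L) := by
    rw [two_mul, pow_add]
    exact Nat.mul_le_mul h1 h1
  have := h.cube
  exact_mod_cast h2.trans (Nat.pow_le_pow_right (by norm_num) (by omega))

/-- `y = 0` is allowed because diagonal cells hold zero denominators; the quotient is then zero. -/
theorem Input.scaled_le (h : Input L N m) {x y : ℤ} (hx : 0 ≤ x ∧ x ≤ 2 ^ L) (hy : 0 ≤ y) :
    0 ≤ x * (denProd m (N * N) / y) ∧ x * (denProd m (N * N) / y) ≤ 2 ^ (5 * L ^ 3) := by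
  obtain ⟨h1, h2⟩ := h.denProd_bounds le_rfl
  have h3 : 0 ≤ denProd m (N * N) / y := Int.ediv_nonneg h1.le hy
  have h4 : denProd m (N * N) / y ≤ 2 ^ (4 * L ^ 3) :=
    (Int.ediv_le_self y h1.le).trans h2
  refine ⟨mul_nonneg hx.1 h3, ?_⟩
  calc x * (denProd m (N * N) / y) ≤ 2 ^ L * 2 ^ (4 * L ^ 3) :=
        mul_le_mul hx.2 h4 h3 (by positivity)
    _ ≤ 2 ^ (5 * L ^ 3) := by
        rw [two_pow_mul_two_pow]
        have := h.cube
        exact two_pow_le_two_pow (by omega)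

theorem Input.neZero (h : Input L N m) : NeZero (48 * L ^ 3) :=
  ⟨by have := h.cube; have := h.L_pos; omega⟩

theorem commonDen_does (h : Input L N m) :
    haveI := h.neZero
    Does (48 * L ^ 3) commonDen m (N * N * 4 + 3) fun m' =>
      ∃ i, m' = { m with W := denProd m (N * N), i := i } := by
  have := h.neZero
  have hc := h.cube
  refine Does.assign_seq (k := N * N * 4 + 2) (denProd m 0) (by simp [denProd]; rfl)
    (fun _ => ?_) <|
    Does.forTo (k := 2) (N * N) (fun j m' => m' = { m with W := denProd m j, i := (j : ℤ) })
    rfl h.sq_le ?_ ?_ ?_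
  · have := h.denProd_bounds (Nat.zero_le _)
    rw [abs_of_pos this.1]
    exact this.2.trans (two_pow_le_two_pow (by omega))
  · rintro j m' rfl
    exact ⟨rfl, by simp [h.n]⟩
  · rintro j m' hj rfl
    have hb := h.denProd_bounds (show j + 1 ≤ N * N by omega)
    refine Does.ite (k := 1) (fun hp => ?_) (fun hp => ?_)
    · replace hp : 0 < m.wpd j := hp
      have hsucc : denProd m j * (m.wpd j * m.wnd j) = denProd m (j + 1) := by
        rw [denProd, denProd, Finset.prod_range_succ, denFactor, if_pos hp]
        ring
      refine Does.assign (k := 0) (denProd m (j + 1)) hsucc (fun _ => ?_) ⟨rfl, rfl⟩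
      rw [abs_of_pos hb.1]
      exact hb.2.trans (two_pow_le_two_pow (by omega))
    · replace hp : m.wpd j ≤ 0 := hp
      have hsucc : denProd m j = denProd m (j + 1) := by
        rw [denProd, denProd, Finset.prod_range_succ, denFactor, if_neg (not_lt.2 hp), mul_one]
      refine Does.skip (k := 0) ⟨rfl, ?_⟩
      simp only [Mem.setVar, hsucc]
      rfl
  · rintro m' rfl
    exact ⟨_, rfl⟩

theorem scale_does (h : Input L N m) {i₀ : ℤ} :
    haveI := h.neZero
    Does (48 * L ^ 3) scale { m with W := denProd m (N * N), i := i₀ } (N * N * 4 + 2) fun m' =>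
      ∃ i a r, m' = { m with W := denProd m (N * N), i := i, a := a, b := r } ∧
        (∀ k : ℕ, k < N * N → a k = m.wpn k * (denProd m (N * N) / m.wpd k)) ∧
        ∀ k : ℕ, k < N * N → r k = m.wnn k * (denProd m (N * N) / m.wnd k) := by
  have := h.neZero
  have hc := h.cube
  refine Does.forTo (k := 2) (N * N) (fun j m' => ∃ a r,
      m' = { m with W := denProd m (N * N), i := (j : ℤ), a := a, b := r } ∧
        (∀ k : ℕ, k < j → a k = m.wpn k * (denProd m (N * N) / m.wpd k)) ∧
        ∀ k : ℕ, k < j → r k = m.wnn k * (denProd m (N * N) / m.wnd k))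
    ⟨m.a, m.b, rfl, fun _ h => by omega, fun _ h => by omega⟩ h.sq_le ?_ ?_ ?_
  · rintro j m' ⟨a, r, rfl, -⟩
    exact ⟨rfl, by simp [h.n]⟩
  · rintro j m' hj ⟨a, r, rfl, h1, h2⟩
    have ha := h.scaled_le (h.wpn j hj) (h.wpd j hj).1
    have hr := h.scaled_le (h.wnn j hj) (h.wnd j hj).1
    refine Does.store_seq (k := 1) j (m.wpn j * (denProd m (N * N) / m.wpd j)) rfl rfl
      (fun _ => ?_) <| Does.store (k := 0) j (m.wnn j * (denProd m (N * N) / m.wnd j)) rfl rfl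
      (fun _ => ?_) ⟨rfl, _, _, rfl, fun k hk => ?_, fun k hk => ?_⟩
    · rw [abs_of_nonneg ha.1]
      exact ha.2.trans (two_pow_le_two_pow (by omega))
    · rw [abs_of_nonneg hr.1]
      exact hr.2.trans (two_pow_le_two_pow (by omega))
    · simp only [Mem.setArr, Function.update_apply, Nat.cast_inj]
      split_ifs with hkj
      · rw [hkj]
      · exact h1 k (by omega)
    · simp only [Mem.setArr, Function.update_apply, Nat.cast_inj]
      split_ifs with hkj
      · rw [hkj]
      · exact h2 k (by omega)
  · rintro m' ⟨a, r, rfl, h1, h2⟩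
    exact ⟨_, a, r, rfl, h1, h2⟩

theorem startVertex_does (h : Input L N m) {i : ℤ} {a r : ℤ → ℤ} {A B : ℤ}
    (hA : A = 2 * (m.l1n * (denProd m (N * N) / m.l1d)))
    (hB : B = 2 * (m.l2n * (denProd m (N * N) / m.l2d))) :
    haveI := h.neZero
    Does (48 * L ^ 3) startVertex { m with W := denProd m (N * N), i := i, a := a, b := r } 6
      fun m' => m' = { m with
        W := denProd m (N * N), i := i, a := a, b := r, A := A, B := B,
        s := Function.update m.s 0 1, P := A, Q := B, go := 1 } := by
  have := h.neZero
  have hc := h.cube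
  have hL := h.L_pos
  have h1 := h.scaled_le h.l1n h.l1d.1.le
  have h2 := h.scaled_le ⟨h.l2n.1.le, h.l2n.2⟩ h.l2d.1.le
  have h3 := two_pow_le_two_pow (show 5 * L ^ 3 + 1 ≤ 48 * L ^ 3 by omega)
  rw [pow_succ] at h3
  have hA' : |A| ≤ 2 ^ (48 * L ^ 3) := by rw [hA, abs_of_nonneg] <;> linarith
  have hB' : |B| ≤ 2 ^ (48 * L ^ 3) := by rw [hB, abs_of_nonneg] <;> linarith
  have h1' : |(1 : ℤ)| ≤ 2 ^ (48 * L ^ 3) := by rw [abs_one]; exact one_le_pow₀ (by norm_num)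
  refine Does.assign_seq (k := 5) A hA.symm (fun _ => hA') ?_
  simp only [Mem.setVar]
  refine Does.assign_seq (k := 4) B hB.symm (fun _ => hB') ?_
  simp only [Mem.setVar]
  refine Does.store_seq (k := 3) 0 1 rfl rfl (fun _ => h1') ?_
  simp only [Mem.setArr]
  refine Does.assign_seq (k := 2) A rfl (fun _ => hA') ?_
  simp only [Mem.setVar]
  refine Does.assign_seq (k := 1) B rfl (fun _ => hB') ?_
  simp only [Mem.setVar]
  exact Does.assign (k := 0) 1 rfl (fun _ => h1') rfl

end

/-- The whole algorithm. -/
def algorithm : Program :=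
  .seq commonDen <| .seq scale <| .seq startVertex <| .loop vgo newtonStep

end DSD

namespace RiskAverseDSD

open RAM DSD

/-! ### Instances in memory -/

theorem matrixArray_apply {n : ℕ} (f : Sym2 (Fin n) → ℤ) (i j : Fin n) :
    matrixArray f ((i : ℕ) * (n : ℤ) + (j : ℕ)) = if i ≠ j then f s(i, j) else 0 := by
  unfold matrixArray
  rw [Finset.sum_eq_single i, Finset.sum_eq_single j]
  · simp
  · intro j' _ hj'
    rw [if_neg]
    rintro ⟨-, h⟩
    rw [index_inj j.2 j'.2] at h
    exact hj' (Fin.ext h.2.symm)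
  · simp
  · intro i' _ hi'
    refine Finset.sum_eq_zero fun j' _ => ?_
    rw [if_neg]
    rintro ⟨-, h⟩
    rw [index_inj j.2 j'.2] at h
    exact hi' (Fin.ext h.1.symm)
  · simp

theorem abs_matrixArray_le {n : ℕ} {f : Sym2 (Fin n) → ℤ} {C : ℤ} (hC : 0 ≤ C)
    (hf : ∀ e, ¬ e.IsDiag → |f e| ≤ C) (k : ℤ) : |matrixArray f k| ≤ n * (n * C) := by
  unfold matrixArray
  calc _ ≤ ∑ i : Fin n, |∑ j : Fin n,
          if i ≠ j ∧ k = ((i : ℕ) : ℤ) * (n : ℤ) + ((j : ℕ) : ℤ) then f s(i, j) else 0| :=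
        Finset.abs_sum_le_sum_abs _ _
    _ ≤ ∑ _i : Fin n, (n * C) := Finset.sum_le_sum fun i _ => by
        refine (Finset.abs_sum_le_sum_abs _ _).trans ?_
        calc _ ≤ ∑ _j : Fin n, C := Finset.sum_le_sum fun j _ => by
              split_ifs with h
              · exact hf _ (by simpa using h.1)
              · simpa using hC
          _ = n * C := by simp
    _ = n * (n * C) := by simp

variable (I : RiskAverseDSD)

/-- The initial memory by names. -/
def inputMem : Mem where
  n := I.n
  l1n := I.lam₁.num
  l1d := I.lam₁.den
  l2n := I.lam₂.num
  l2d := I.lam₂.den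
  W := 0
  A := 0
  B := 0
  P := 0
  Q := 0
  mu := 0
  go := 0
  chg := 0
  u := 0
  v := 0
  dl := 0
  k := 0
  i := 0
  wpn := matrixArray fun e => (I.wPos e).num
  wpd := matrixArray fun e => ((I.wPos e).den : ℤ)
  wnn := matrixArray fun e => (I.wNeg e).num
  wnd := matrixArray fun e => ((I.wNeg e).den : ℤ)
  s := fun _ => 0
  a := fun _ => 0
  b := fun _ => 0
  x := fun _ => 0
  l := fun _ => 0
  d := fun _ => 0

theorem enc_inputMem : I.inputMem.enc = I.input := by
  unfold Mem.enc input
  rw [State.mk.injEq]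
  constructor
  · funext y
    rcases y with _ | _ | _ | _ | _ | _ | _ | _ | _ | _ | _ | _ | _ | _ | _ | _ | _ | _ | y <;> rfl
  · funext y
    rcases y with _ | _ | _ | _ | _ | _ | _ | _ | _ | _ | y <;> rfl

theorem mem_inducedEdges_univ {e : Sym2 (Fin I.n)} (he : ¬ e.IsDiag) :
    e ∈ inducedEdges (Finset.univ : Finset (Fin I.n)) := by
  simp [inducedEdges, he]

theorem ratBits_weights_le {e : Sym2 (Fin I.n)} (he : ¬ e.IsDiag) :
    ratBits (I.wPos e) + ratBits (I.wNeg e) ≤ I.size := by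
  have := Finset.single_le_sum (f := fun e => ratBits (I.wPos e) + ratBits (I.wNeg e))
    (fun _ _ => Nat.zero_le _) (I.mem_inducedEdges_univ he)
  unfold size
  omega

/-- The bit length of `n` alone would give only a logarithmic bound. The star at vertex `0` has `n -
1` edges, and each of them contributes to the size. -/
theorem n_le_size : I.n ≤ I.size := by
  have h0 : I.n - 1 ≤ (inducedEdges (Finset.univ : Finset (Fin I.n))).card := by
    let z : Fin I.n := ⟨0, I.n_pos⟩
    have h1 : (Finset.univ.erase z).card = I.n - 1 := by
      rw [Finset.card_erase_of_mem (Finset.mem_univ _)]; simp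
    rw [← h1]
    refine Finset.card_le_card_of_injOn (fun j => s(z, j)) (fun j hj => ?_) fun j _ j' _ h => ?_
    · refine I.mem_inducedEdges_univ ?_
      simp at hj
      simpa using Ne.symm hj
    · rcases Sym2.eq_iff.1 h with h | h
      exacts [h.2, h.2.trans h.1]
  have h2 : (inducedEdges (Finset.univ : Finset (Fin I.n))).card
      ≤ ∑ e ∈ inducedEdges (Finset.univ : Finset (Fin I.n)),
        (ratBits (I.wPos e) + ratBits (I.wNeg e)) := by
    rw [Finset.card_eq_sum_ones]
    refine Finset.sum_le_sum fun e _ => ?_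
    unfold ratBits bits
    omega
  have h3 : 1 ≤ bits (I.n : ℤ) := by unfold bits; omega
  unfold size
  omega

theorem abs_le_of_bits_le {z : ℤ} {L : ℕ} (h : bits z ≤ L) : |z| ≤ 2 ^ L := by
  have h1 : z.natAbs < 2 ^ Nat.size z.natAbs := Nat.lt_size_self _
  have h2 : 2 ^ Nat.size z.natAbs ≤ 2 ^ L :=
    Nat.pow_le_pow_right (by norm_num) (by unfold bits at h; omega)
  rw [Int.abs_eq_natAbs]
  exact_mod_cast h1.le.trans h2

theorem rat_le_of_ratBits_le {x : ℚ} {L : ℕ} (h : ratBits x ≤ L) :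
    |x.num| ≤ 2 ^ L ∧ |(x.den : ℤ)| ≤ 2 ^ L := by
  unfold ratBits at h
  exact ⟨abs_le_of_bits_le (by omega), abs_le_of_bits_le (by omega)⟩

theorem exists_index {N k : ℕ} (hk : k < N * N) :
    ∃ i j : Fin N, (k : ℤ) = (i : ℕ) * (N : ℤ) + (j : ℕ) := by
  have hN : 0 < N := Nat.pos_of_ne_zero (by rintro rfl; simp at hk)
  refine ⟨⟨k / N, Nat.div_lt_of_lt_mul hk⟩, ⟨k % N, Nat.mod_lt _ hN⟩, ?_⟩
  have := Nat.div_add_mod k N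
  push_cast
  rw [mul_comm]
  exact_mod_cast this.symm

theorem input_inputMem : Input I.size I.n I.inputMem := by
  have hl1 : ratBits I.lam₁ ≤ I.size := by unfold size; omega
  have hl2 : ratBits I.lam₂ ≤ I.size := by unfold size; omega
  have e1 := rat_le_of_ratBits_le hl1
  have e2 := rat_le_of_ratBits_le hl2
  have hp : ∀ e : Sym2 (Fin I.n), ¬ e.IsDiag → _ := fun e he =>
    rat_le_of_ratBits_le (x := I.wPos e) (L := I.size)
      ((Nat.le_add_right _ _).trans (I.ratBits_weights_le he))
  have hn : ∀ e : Sym2 (Fin I.n), ¬ e.IsDiag → _ := fun e he =>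
    rat_le_of_ratBits_le (x := I.wNeg e) (L := I.size)
      ((Nat.le_add_left _ _).trans (I.ratBits_weights_le he))
  have key : ∀ f : Sym2 (Fin I.n) → ℤ, (∀ e, ¬ e.IsDiag → 0 ≤ f e ∧ |f e| ≤ 2 ^ I.size) →
      ∀ k : ℕ, k < I.n * I.n → 0 ≤ matrixArray f k ∧ matrixArray f k ≤ 2 ^ I.size := by
    intro f hf k hk
    obtain ⟨i, j, hij⟩ := exists_index hk
    rw [hij, matrixArray_apply]
    split_ifs with h
    · have := hf s(i, j) (by simpa using h)
      exact ⟨this.1, (le_abs_self _).trans this.2⟩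
    · exact ⟨le_rfl, by positivity⟩
  refine ⟨I.n_le_size, I.n_pos, rfl, ⟨?_, (le_abs_self _).trans e1.1⟩,
    ⟨?_, (le_abs_self _).trans e1.2⟩, ⟨?_, (le_abs_self _).trans e2.1⟩,
    ⟨?_, (le_abs_self _).trans e2.2⟩, ?_, ?_, ?_, ?_, ?_⟩
  · exact Rat.num_nonneg.2 I.lam₁_nonneg
  · exact Int.natCast_pos.2 I.lam₁.den_pos
  · exact Rat.num_pos.2 I.lam₂_pos
  · exact Int.natCast_pos.2 I.lam₂.den_pos
  · exact key _ fun e he => ⟨Rat.num_nonneg.2 (I.wPos_nonneg e), (hp e he).1⟩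
  · exact key _ fun e he => ⟨Rat.num_nonneg.2 (I.wNeg_nonneg e), (hn e he).1⟩
  · exact key _ fun e he => ⟨by positivity, (hp e he).2⟩
  · exact key _ fun e he => ⟨by positivity, (hn e he).2⟩
  · intro k hk
    obtain ⟨i, j, hij⟩ := exists_index hk
    simp only [inputMem]
    rw [hij, matrixArray_apply, matrixArray_apply]
    split_ifs with h
    · have h1 := (I.wPos s(i, j)).den_pos
      have h2 := (I.wNeg s(i, j)).den_pos
      exact ⟨fun _ => by exact_mod_cast h2, fun _ => by exact_mod_cast h1⟩
    · rfl

/-- The bound must hold at every integer address, so the whole double sum in `matrixArray` is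
estimated rather than a single entry. -/
theorem bdd_inputMem : I.inputMem.enc.Bdd (48 * I.size ^ 3) := by
  have h := I.input_inputMem
  have hc := h.cube
  have hL := two_pow_le_two_pow (show I.size ≤ 48 * I.size ^ 3 by omega)
  have h0 : |(0 : ℤ)| ≤ 2 ^ (48 * I.size ^ 3) := by simp
  have harr : ∀ f : Sym2 (Fin I.n) → ℤ, (∀ e, ¬ e.IsDiag → |f e| ≤ 2 ^ I.size) →
      ∀ k, |matrixArray f k| ≤ 2 ^ (48 * I.size ^ 3) := by
    intro f hf k
    have hn : (I.n : ℤ) ≤ 2 ^ I.size := by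
      exact_mod_cast h.N_le.trans Nat.lt_two_pow_self.le
    calc |matrixArray f k| ≤ I.n * (I.n * 2 ^ I.size) :=
          abs_matrixArray_le (by positivity) hf k
      _ ≤ 2 ^ I.size * (2 ^ I.size * 2 ^ I.size) := by gcongr
      _ = 2 ^ (I.size + (I.size + I.size)) := by rw [pow_add, pow_add]
      _ ≤ _ := two_pow_le_two_pow (by omega)
  have hp : ∀ e : Sym2 (Fin I.n), ¬ e.IsDiag → _ := fun e he =>
    rat_le_of_ratBits_le (x := I.wPos e) (L := I.size)
      ((Nat.le_add_right _ _).trans (I.ratBits_weights_le he))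
  have hn : ∀ e : Sym2 (Fin I.n), ¬ e.IsDiag → _ := fun e he =>
    rat_le_of_ratBits_le (x := I.wNeg e) (L := I.size)
      ((Nat.le_add_left _ _).trans (I.ratBits_weights_le he))
  have hnn : |(I.n : ℤ)| ≤ 2 ^ I.size := by
    rw [abs_of_nonneg (by positivity)]
    exact_mod_cast h.N_le.trans Nat.lt_two_pow_self.le
  have hpos : ∀ {z : ℤ}, 0 ≤ z → z ≤ 2 ^ I.size → |z| ≤ 2 ^ (48 * I.size ^ 3) :=
    fun h1 h2 => by rw [abs_of_nonneg h1]; exact h2.trans hL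
  constructor
  · intro y
    rcases y with _ | _ | _ | _ | _ | _ | _ | _ | _ | _ | _ | _ | _ | _ | _ | _ | _ | _ | y
    · exact hnn.trans hL
    · exact hpos h.l1n.1 h.l1n.2
    · exact hpos h.l1d.1.le h.l1d.2
    · exact hpos h.l2n.1.le h.l2n.2
    · exact hpos h.l2d.1.le h.l2d.2
    all_goals exact h0
  · intro y k
    rcases y with _ | _ | _ | _ | _ | _ | _ | _ | _ | _ | y
    · exact harr _ (fun e he => (hp e he).1) k
    · exact harr _ (fun e he => (hp e he).2) k
    · exact harr _ (fun e he => (hn e he).1) k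
    · exact harr _ (fun e he => (hn e he).2) k
    all_goals exact h0

/-! ### The objective in terms of integers -/

/-- Each edge arises from two ordered pairs, exchanged by `Prod.swap`; the pairs with first entry
smaller represent the edges. -/
theorem sum_sum_eq_two_mul {n : ℕ} (F : Sym2 (Fin n) → ℚ) (S : Finset (Fin n)) :
    ∑ u ∈ S, ∑ v ∈ S, (if u ≠ v then F s(u, v) else 0) = 2 * ∑ e ∈ inducedEdges S, F e := by
  have h1 : ∑ u ∈ S, ∑ v ∈ S, (if u ≠ v then F s(u, v) else 0)
      = ∑ p ∈ S.offDiag, F s(p.1, p.2) := by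
    have h0 : S.offDiag = (S ×ˢ S).filter fun p => p.1 ≠ p.2 := by
      ext p; simp [and_assoc]
    rw [h0, Finset.sum_filter, Finset.sum_product]
  have h2 : ∑ e ∈ inducedEdges S, F e = ∑ p ∈ S.offDiag with p.1 < p.2, F s(p.1, p.2) := by
    rw [← Finset.sum_sym2_filter_not_isDiag]
    rfl
  have h3 : ∑ p ∈ S.offDiag with ¬ p.1 < p.2, F s(p.1, p.2)
      = ∑ p ∈ S.offDiag with p.1 < p.2, F s(p.1, p.2) := by
    refine Finset.sum_nbij' Prod.swap Prod.swap ?_ ?_ ?_ ?_ ?_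
    · rintro ⟨p, q⟩ h
      simp only [Finset.mem_filter, Finset.mem_offDiag, Prod.swap] at h ⊢
      refine ⟨⟨h.1.2.1, h.1.1, h.1.2.2.symm⟩, ?_⟩
      have := h.1.2.2
      omega
    · rintro ⟨p, q⟩ h
      simp only [Finset.mem_filter, Finset.mem_offDiag, Prod.swap] at h ⊢
      exact ⟨⟨h.1.2.1, h.1.1, h.1.2.2.symm⟩, by omega⟩
    · intro _ _; simp
    · intro _ _; simp
    · rintro ⟨p, q⟩ _
      simp [Sym2.eq_swap]
  rw [h1, h2, ← Finset.sum_filter_add_sum_filter_not S.offDiag (fun p => p.1 < p.2), h3]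
  ring

/-- A product of denominators clears a denominator. -/
theorem cast_num_mul_div {x : ℚ} {W : ℤ} (h : (x.den : ℤ) ∣ W) :
    ((x.num * (W / (x.den : ℤ)) : ℤ) : ℚ) = W * x := by
  obtain ⟨t, rfl⟩ := h
  have hd : (x.den : ℤ) ≠ 0 := by exact_mod_cast x.den_ne_zero
  rw [Int.mul_ediv_cancel_left _ hd]
  push_cast
  nth_rewrite 3 [← Rat.num_div_den x]
  have : (x.den : ℚ) ≠ 0 := by exact_mod_cast x.den_ne_zero
  field_simp

/-- The factor `2` in the scaled parameter compensates for each edge being counted twice, so that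
the whole objective is scaled uniformly. -/
theorem total_eq {N : ℕ} {W A : ℤ} {lam : ℚ} {w : Sym2 (Fin N) → ℚ} {a : Fin N → Fin N → ℤ}
    (hA : (A : ℚ) = 2 * (W * lam)) (ha : ∀ u v, (a u v : ℚ) = if u ≠ v then W * w s(u, v) else 0)
    (S : Finset (Fin N)) :
    (total A a S : ℚ) = 2 * W * (∑ e ∈ inducedEdges S, w e + lam * S.card) := by
  unfold total
  push_cast
  rw [Finset.sum_add_distrib, Finset.sum_const, nsmul_eq_mul, hA]
  simp_rw [ha]
  rw [sum_sum_eq_two_mul (fun e => W * w e), ← Finset.mul_sum]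
  ring

end RiskAverseDSD

/-! ### The scaled instance and the whole algorithm -/

namespace RiskAverseDSD

open RAM DSD

variable (I : RiskAverseDSD)

/-- The common denominator of all weights and parameters. -/
def commonDenominator : ℤ := denProd I.inputMem (I.n * I.n)

theorem commonDenominator_pos : 0 < I.commonDenominator :=
  (I.input_inputMem.denProd_bounds le_rfl).1

/-- A matrix of scaled weights. -/
def scaled (w : Sym2 (Fin I.n) → ℚ) (u v : Fin I.n) : ℤ :=
  if u ≠ v then (w s(u, v)).num * (I.commonDenominator / ((w s(u, v)).den : ℤ)) else 0

/-- A scaled parameter, doubled. -/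
def scaledParam (x : ℚ) : ℤ := 2 * (x.num * (I.commonDenominator / (x.den : ℤ)))

theorem index_lt {N : ℕ} (u v : Fin N) : (u : ℕ) * N + v < N * N := by
  have hu := u.2
  have hv := v.2
  calc (u : ℕ) * N + v < u * N + N := by omega
    _ = (u + 1) * N := by ring
    _ ≤ N * N := Nat.mul_le_mul_right _ hu

/-- The cell of an off-diagonal pair contributes both of its denominators as one factor of the
product. -/
theorem den_dvd {u v : Fin I.n} (huv : u ≠ v) :
    ((I.wPos s(u, v)).den : ℤ) ∣ I.commonDenominator ∧
      ((I.wNeg s(u, v)).den : ℤ) ∣ I.commonDenominator := by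
  have h1 : denFactor I.inputMem ((u : ℕ) * I.n + v) ∣ I.commonDenominator :=
    (Finset.dvd_prod_of_mem _ (Finset.mem_range.2 (index_lt u v))).trans (Dvd.intro_left _ rfl)
  have h2 : denFactor I.inputMem ((u : ℕ) * I.n + v)
      = (I.wPos s(u, v)).den * (I.wNeg s(u, v)).den := by
    unfold denFactor
    simp only [inputMem]
    push_cast
    rw [matrixArray_apply, matrixArray_apply, if_pos huv, if_pos huv, if_pos]
    exact_mod_cast (I.wPos s(u, v)).den_pos
  rw [h2] at h1
  exact ⟨(Dvd.intro _ rfl).trans h1, (Dvd.intro_left _ rfl).trans h1⟩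

theorem scaled_cast {w : Sym2 (Fin I.n) → ℚ}
    (hw : ∀ u v : Fin I.n, u ≠ v → ((w s(u, v)).den : ℤ) ∣ I.commonDenominator) (u v : Fin I.n) :
    (I.scaled w u v : ℚ) = if u ≠ v then I.commonDenominator * w s(u, v) else 0 := by
  unfold scaled
  split_ifs with h
  · exact cast_num_mul_div (hw u v h)
  · simp

theorem scaledParam_cast {x : ℚ} (hx : (x.den : ℤ) ∣ I.commonDenominator) :
    (I.scaledParam x : ℚ) = 2 * (I.commonDenominator * x) := by
  rw [scaledParam, Int.cast_mul, cast_num_mul_div hx]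
  norm_num

/-- The scaled numerator of the objective. -/
theorem total_reward (S : Finset (Fin I.n)) :
    (total (I.scaledParam I.lam₁) (I.scaled I.wPos) S : ℚ) = 2 * I.commonDenominator *
      (∑ e ∈ inducedEdges S, I.wPos e + I.lam₁ * S.card) :=
  total_eq (I.scaledParam_cast
      ((Dvd.intro _ rfl : I.inputMem.l1d ∣ _ * _).trans (Dvd.intro _ rfl)))
    (I.scaled_cast fun _ _ h => (I.den_dvd h).1) S

/-- The scaled denominator of the objective. -/
theorem total_risk (S : Finset (Fin I.n)) :
    (total (I.scaledParam I.lam₂) (I.scaled I.wNeg) S : ℚ) = 2 * I.commonDenominator *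
      (∑ e ∈ inducedEdges S, I.wNeg e + I.lam₂ * S.card) :=
  total_eq (I.scaledParam_cast
      ((Dvd.intro_left _ rfl : I.inputMem.l2d ∣ _ * _).trans (Dvd.intro _ rfl)))
    (I.scaled_cast fun _ _ h => (I.den_dvd h).2) S

theorem objective_eq (S : Finset (Fin I.n)) :
    I.objective S = total (I.scaledParam I.lam₁) (I.scaled I.wPos) S /
      total (I.scaledParam I.lam₂) (I.scaled I.wNeg) S := by
  have : (I.commonDenominator : ℚ) ≠ 0 := by exact_mod_cast I.commonDenominator_pos.ne'
  rw [total_reward, total_risk, mul_div_mul_left _ _ (by simpa using this)]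
  rfl

theorem objective_le_qMax {S : Finset (Fin I.n)} (hS : S.Nonempty) : I.objective S ≤ I.qMax :=
  Finset.le_sup' _ (by simpa [candidates] using hS)

theorem scaled_bounds {w : Sym2 (Fin I.n) → ℚ} (hw : ∀ e, 0 ≤ w e)
    (hL : ∀ e : Sym2 (Fin I.n), ¬ e.IsDiag → (w e).num ≤ 2 ^ I.size) (u v : Fin I.n) :
    0 ≤ I.scaled w u v ∧ I.scaled w u v ≤ 2 ^ (6 * I.size ^ 3) := by
  unfold scaled
  split_ifs with h
  · have := I.input_inputMem.scaled_le ⟨Rat.num_nonneg.2 (hw s(u, v)), hL _ (by simpa using h)⟩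
      (Int.natCast_nonneg (w s(u, v)).den)
    exact ⟨this.1, this.2.trans (two_pow_le_two_pow (by omega))⟩
  · exact ⟨le_rfl, by positivity⟩

theorem scaledParam_bounds {x : ℚ} (hx : 0 ≤ x) (hL : x.num ≤ 2 ^ I.size) :
    0 ≤ I.scaledParam x ∧ I.scaledParam x ≤ 2 ^ (6 * I.size ^ 3) := by
  have h1 := I.input_inputMem.scaled_le ⟨Rat.num_nonneg.2 hx, hL⟩ (Int.natCast_nonneg x.den)
  have hc := I.input_inputMem.cube
  have hL := I.input_inputMem.L_pos
  have h2 := two_pow_le_two_pow (show 5 * I.size ^ 3 + 1 ≤ 6 * I.size ^ 3 by omega)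
  rw [pow_succ] at h2
  unfold scaledParam commonDenominator
  constructor <;> linarith

theorem scaledParam_pos {x : ℚ} (hx : 0 < x) (hd : (x.den : ℤ) ∣ I.commonDenominator) :
    0 < I.scaledParam x := by
  have h := I.scaledParam_cast hd
  have : (0 : ℚ) < I.commonDenominator := by exact_mod_cast I.commonDenominator_pos
  have h2 : (0 : ℚ) < I.scaledParam x := by rw [h]; positivity
  exact_mod_cast h2

/-- Scaled weights fit into `5 * L ^ 3` bits and the doubled parameters need one more, hence `6 * L
^ 3`. The promise passes to every `S` because `objective S ≤ qMax` and risks are nonnegative;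
clearing denominators gives the integral form, and on the diagonal both sides vanish. -/
theorem admissible
    (h : ∀ e : Sym2 (Fin I.n), ¬ e.IsDiag → I.qMax * I.wNeg e ≤ I.wPos e) :
    Admissible (6 * I.size ^ 3) (I.scaledParam I.lam₁) (I.scaledParam I.lam₂)
      (I.scaled I.wPos) (I.scaled I.wNeg) := by
  have hin := I.input_inputMem
  have hc := hin.cube
  have hL := hin.L_pos
  have hA := I.scaledParam_bounds I.lam₁_nonneg hin.l1n.2
  have hB := I.scaledParam_bounds I.lam₂_pos.le hin.l2n.2
  have hBpos : 0 < I.scaledParam I.lam₂ := I.scaledParam_pos I.lam₂_pos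
    ((Dvd.intro_left _ rfl : I.inputMem.l2d ∣ _ * _).trans (Dvd.intro _ rfl))
  have ha := I.scaled_bounds I.wPos_nonneg fun e he => (le_abs_self _).trans
    (rat_le_of_ratBits_le ((Nat.le_add_right _ _).trans (I.ratBits_weights_le he))).1
  have hr := I.scaled_bounds I.wNeg_nonneg fun e he => (le_abs_self _).trans
    (rat_le_of_ratBits_le ((Nat.le_add_left _ _).trans (I.ratBits_weights_le he))).1
  refine ⟨by omega, ?_, hA.1, hA.2, hBpos, hB.2, fun u v => (ha u v).1, fun u v => (ha u v).2,
    fun u v => (hr u v).1, fun u v => (hr u v).2, fun S hS u v => ?_⟩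
  · have h1 : I.n ≤ 2 ^ I.size := hin.N_le.trans Nat.lt_two_pow_self.le
    exact_mod_cast h1.trans (Nat.pow_le_pow_right (by norm_num) (by omega))
  · by_cases huv : u = v
    · simp [scaled, huv]
    · have hD : 0 < total (I.scaledParam I.lam₂) (I.scaled I.wNeg) S :=
        total_pos hBpos (fun u v => (hr u v).1) hS
      have hD' : (0 : ℚ) < total (I.scaledParam I.lam₂) (I.scaled I.wNeg) S := by exact_mod_cast hD
      have hW : (0 : ℚ) < I.commonDenominator := by exact_mod_cast I.commonDenominator_pos
      have h1 : I.objective S * I.wNeg s(u, v) ≤ I.wPos s(u, v) :=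
        (mul_le_mul_of_nonneg_right (I.objective_le_qMax hS) (I.wNeg_nonneg _)).trans
          (h _ (by simpa using huv))
      rw [objective_eq, div_mul_eq_mul_div, div_le_iff₀ hD'] at h1
      have h2 := I.scaled_cast (fun _ _ h => (I.den_dvd h).1) u v
      have h3 := I.scaled_cast (fun _ _ h => (I.den_dvd h).2) u v
      rw [if_pos huv] at h2 h3
      have h4 : ((total (I.scaledParam I.lam₁) (I.scaled I.wPos) S * I.scaled I.wNeg u v : ℤ) : ℚ)
          ≤ ((total (I.scaledParam I.lam₂) (I.scaled I.wNeg) S * I.scaled I.wPos u v : ℤ) : ℚ) := by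
        push_cast
        rw [h2, h3]
        nlinarith [mul_le_mul_of_nonneg_left h1 hW.le]
      exact_mod_cast h4

/-- The number of elementary commands of the whole algorithm. -/
def commandCount (L : ℕ) : ℕ :=
  (L * L * 4 + 3) + ((L * L * 4 + 2) + (6 + ((48 * L ^ 3 + 2) * (stepCount L + 1) + 1)))

/-- Newton's method starts from `{0}`: as diagonal weights are zero, its value is given by the
scaled parameters alone. Cross-multiplied optimality of the totals is optimality of the objective,
the common factor `2 * W` cancelling. -/
theorem algorithm_does
    (h : ∀ e : Sym2 (Fin I.n), ¬ e.IsDiag → I.qMax * I.wNeg e ≤ I.wPos e) :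
    Does (48 * I.size ^ 3) algorithm I.inputMem (commandCount I.size) fun m =>
      ∃ S : Finset (Fin I.n), (∀ u : Fin I.n, m.s u = if u ∈ S then 1 else 0) ∧ I.IsOptimal S := by
  have hin := I.input_inputMem
  have hadm := I.admissible h
  set A := I.scaledParam I.lam₁ with hA
  set B := I.scaledParam I.lam₂ with hB
  have hN := hin.N_le
  refine Does.mono (k := (I.n * I.n * 4 + 3) + ((I.n * I.n * 4 + 2) +
    (6 + ((8 * (6 * I.size ^ 3) + 2) * (stepCount I.n + 1) + 1)))) ?_ ?_ fun _ h => h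
  · refine Does.seq <| (commonDen_does hin).mono le_rfl ?_
    rintro _ ⟨i₀, rfl⟩
    refine Does.seq <| (scale_does hin).mono le_rfl ?_
    rintro _ ⟨i, a, r, rfl, ha, hr⟩
    refine Does.seq <| (startVertex_does hin (A := A) (B := B) hA hB).mono le_rfl ?_
    rintro _ rfl
    have e48 : 48 * I.size ^ 3 = 8 * (6 * I.size ^ 3) := by ring
    rw [e48]
    let z : Fin I.n := ⟨0, I.n_pos⟩
    refine (newton_does hadm (S := {z}) (Finset.singleton_nonempty z) ⟨rfl, rfl, rfl, ?_, ?_⟩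
      ⟨?_, ?_, ?_⟩ rfl).mono le_rfl ?_
    · intro u v
      have := ha _ (index_lt u v)
      push_cast at this
      refine this.trans ?_
      simp only [inputMem, matrixArray_apply, scaled]
      split_ifs
      · rfl
      · simp
    · intro u v
      have := hr _ (index_lt u v)
      push_cast at this
      refine this.trans ?_
      simp only [inputMem, matrixArray_apply, scaled]
      split_ifs
      · rfl
      · simp
    · intro u
      show Function.update (fun _ => (0 : ℤ)) 0 1 ((u : ℕ) : ℤ) = _
      rw [Function.update_apply]
      have : ((u : ℕ) : ℤ) = 0 ↔ u ∈ ({z} : Finset (Fin I.n)) := by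
        rw [Finset.mem_singleton, Fin.ext_iff]
        exact_mod_cast Iff.rfl
      simp only [this]
    · simp [total, scaled]
    · simp [total, scaled]
    · rintro m' ⟨S, hS, hs, hopt⟩
      refine ⟨S, hs, hS, fun T hT => ?_⟩
      have hpos : ∀ T : Finset (Fin I.n), T.Nonempty →
          (0 : ℚ) < total B (I.scaled I.wNeg) T := fun T hT => by
        exact_mod_cast total_pos hadm.B_pos hadm.r_nonneg hT
      rw [objective_eq, objective_eq, div_le_div_iff₀ (hpos T hT) (hpos S hS)]
      exact_mod_cast hopt T
  -- The count is monotone in the number of vertices, so `n ≤ L` replaces it by a function of `L`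
  -- only.
  · have hstep : stepCount I.n ≤ stepCount I.size := by
      unfold stepCount sweeps
      gcongr
    have e48 : 8 * (6 * I.size ^ 3) = 48 * I.size ^ 3 := by ring
    unfold commandCount
    rw [e48]
    gcongr

theorem exists_polynomial : ∃ p : Polynomial ℕ, ∀ L,
    p.eval L = commandCount L * unitCost (48 * L ^ 3) := by
  let x : Polynomial ℕ := Polynomial.X
  refine ⟨((x * x * 4 + 3) + ((x * x * 4 + 2) + (6 + ((48 * x ^ 3 + 2) *
    (((x * (x * 4 + 6) + 2) + (((x + 1) * (x * (x * x) + x * x) + 1) * (x * (x * 14 + 9) + 4) + 2) +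
      (x * 4 + 3) + ((x + 1) * (x * 4 + 4) + 3) + (x * 4 + 2) + (x * (x * 4 + 6) + 4) + 2) + 1)
      + 1)))) * (1 + 2 * (40 * (48 * x ^ 3 * 40 + 2))), fun L => ?_⟩
  simp [x, commandCount, unitCost, stepCount, sweeps]

end RiskAverseDSD

/-! ### The main theorem -/

theorem mainTheorem3 :
    ∃ (c : RAM.Program) (p : Polynomial ℕ), ∀ I : RiskAverseDSD,
      (∀ e : Sym2 (Fin I.n), ¬ e.IsDiag → I.qMax * I.wNeg e ≤ I.wPos e) →
        ∃ (t : ℕ) (s : RAM.State) (S : Finset (Fin I.n)),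
          RAM.Exec c I.input t s ∧ t ≤ p.eval I.size ∧ I.Outputs s S ∧ I.IsOptimal S := by
  obtain ⟨p, hp⟩ := RiskAverseDSD.exists_polynomial
  refine ⟨DSD.algorithm, p, fun I hI => ?_⟩
  obtain ⟨t, m, hexec, ht, -, S, hs, hopt⟩ := I.algorithm_does hI I.bdd_inputMem
  rw [I.enc_inputMem] at hexec
  exact ⟨t, m.enc, S, hexec, (hp I.size).symm ▸ ht, hs, hopt⟩
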